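/- Let $Q_n$ be the $n$-dimensional hypercube graph (vertices: binary sequences of length $n$; two vertices are adjacent if and only if they differ in exactly one position), and let $C_m$ be the cycle on $m$ vertices. For graphs $G,T,H$ let $N(G,T)$ be the number of subgraphs of $G$ isomorphic to $T$, let $\mathrm{ex}(G,T,H)$ be the maximum of $N(G',T)$ over all subgraphs $G'\subseteq G$ having no subgraph isomorphic to $H$, and let $\mathbf d(G,T,H)=\mathrm{ex}(G,T,H)/N(G,T)$. For $\ell\ge 2$ let $z_{\ell,\ell}$ be the number of copies of $C_{2\ell}$ in $Q_\ell$ whose edges use all $\ell$ directions, that is, such that for each of the $\ell$ coordinates some edge of the copy has endpoints differing in that coordinate. There is an absolute constant $\alpha>0$ such that for all integers $k\ge 2$ and $\ell\ge 2$ with $(k,\ell)\neq(2,2)$ (i.e. $C_{2\ell}\not\cong Q_k$) and all sufficiently large $n$ (depending on $k$ and $\ell$), $$\max\left\{\left(1-\frac1k\right)\frac{(\ell-1)!}{2z_{\ell,\ell}}\,(1-o(1)),\; 1-\frac{\ell}{k}\right\}\;\le\;\mathbf d(Q_n,C_{2\ell},Q_k)\;\le\;1-\alpha\,\frac{\log k}{k2^k},$$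 where the term $o(1)$ is non-negative and tends to $0$ as $n\to\infty$ with $k,\ell$ fixed. -/

import Mathlib

open Filter Topology

/-- The hypercube `Q_n`: the vertices are the binary sequences of length `n`, and two of them are
adjacent iff they differ in exactly one position. -/
def hypercube (n : ℕ) : SimpleGraph (Fin n → Bool) where
  Adj x y := hammingDist x y = 1
  symm := ⟨fun x y h => by rw [hammingDist_comm]; exact h⟩
  loopless := ⟨fun x h => by simp at h⟩

open Classical in
/-- The generalized extremal function `ex(G, T, H)`: the maximum, over all `H`-free subgraphs `G'`
of `G`, of the number `N(G', T)` of subgraphs of `G'` isomorphic to `T`. -/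
noncomputable def genEx {V U W : Type*} [Fintype V] (G : SimpleGraph V) (T : SimpleGraph U)
    (H : SimpleGraph W) : ℕ :=
  (Finset.univ.filter fun G' : G.Subgraph => H.Free G'.coe).sup fun G' => G'.coe.copyCount T

/-- The generalized Turán density `d(G, T, H) = ex(G, T, H) / N(G, T)`. -/
noncomputable def genTuranDensity {V U W : Type*} [Fintype V] (G : SimpleGraph V)
    (T : SimpleGraph U) (H : SimpleGraph W) : ℝ :=
  (genEx G T H : ℝ) / (G.copyCount T : ℝ)

/-- The set of star (flip) positions of the edges of a subgraph `S` of `Q_n`: the coordinates in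
which the two endpoints of some edge of `S` differ. -/
def starPositions {n : ℕ} (S : (hypercube n).Subgraph) : Set (Fin n) :=
  {i | ∃ x y, S.Adj x y ∧ x i ≠ y i}

/-- `z_{k,ℓ}`: the number of copies of the cycle `C_{2ℓ}` in `Q_k` that use exactly `k` different
star positions on their edges. -/
noncomputable def cubeCycleCount (k ℓ : ℕ) : ℕ :=
  Set.ncard {S : (hypercube k).Subgraph |
    Nonempty (SimpleGraph.cycleGraph (2 * ℓ) ≃g S.coe) ∧ (starPositions S).ncard = k}

/-! All densities are computed with labelled copies. Each subgraph isomorphic to `T` carries `|Aut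
T|` labellings, and this factor cancels in the quotient.

Upper bound. Since automorphisms of the cube act transitively on oriented edges, averaging over them
shows that a subgraph loses at least as large a proportion of copies of `T` as of edges
(`card_aut_missing_mul_le`). In a copy of `Q_{k+2}`, let `S` be the set of endpoints of missing
edges. If two coordinates agreed on all of `S`, the `k`-dimensional subcube giving them different
values would avoid `S`, hence be complete. So the `k + 2` coordinates are distinct functions on `S`,
and `|S| ≥ log₂ (k + 2)` (`le_two_pow_card_missing`).

Lower bounds. Remove the edges whose lower endpoint has weight `r` modulo `k`. Weights in a copy of
`Q_k` grow with the distance from a lowest vertex, so the copy meets `k` consecutive levels and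
loses an edge (`exists_edge_level_copy`). A `2ℓ`-cycle meets at most `ℓ` levels, and averaging over
`r` gives `1 - ℓ / k`. Zigzag cycles between two consecutive layers meet one level, so some `r`
keeps a proportion `1 - 1 / k` of them. They make up about `(ℓ - 1)! / (2 z)` of all cycles, `z`
being `z_{ℓ,ℓ}`: there are `n.descFactorial ℓ * 2 ^ (n - ℓ) * 2` labelled zigzags, against at most
`n.choose ℓ * 2 ^ (n - ℓ) * z * 4ℓ` labelled cycles with `ℓ` directions and `O(2 ^ n * n ^ (ℓ - 1))`
with fewer. -/

namespace SimpleGraph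

/-! ### Labelled copies and the generalized Turán density -/

variable {V U W : Type*}

instance Copy.instFinite [Finite U] [Finite V] (T : SimpleGraph U) (G : SimpleGraph V) :
    Finite (Copy T G) := DFunLike.finite _

instance Iso.instFinite [Finite U] [Finite V] (T : SimpleGraph U) (G : SimpleGraph V) :
    Finite (T ≃g G) := DFunLike.finite _

/-- Every subgraph isomorphic to `T` is the image of exactly `|Aut T|` labelled copies of `T`. -/
theorem ncard_copy_toSubgraph [Finite U] [Finite V] (T : SimpleGraph U) (G : SimpleGraph V)
    (P : G.Subgraph → Prop) :
    {f : Copy T G | P f.toSubgraph}.ncard =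
      {S : G.Subgraph | Nonempty (T ≃g S.coe) ∧ P S}.ncard * Nat.card (T ≃g T) := by
  classical
  rw [← Nat.card_coe_set_eq, ← Nat.card_coe_set_eq, ← Nat.card_prod]
  symm
  -- One isomorphism onto each subgraph is fixed; every other one differs from it by an automorphism
  -- of `T`.
  let e (S : {S : G.Subgraph | Nonempty (T ≃g S.coe) ∧ P S}) : T ≃g S.1.coe := S.2.1.some
  let F (p : {S : G.Subgraph | Nonempty (T ≃g S.coe) ∧ P S} × (T ≃g T)) : Copy T G :=
    ⟨p.1.1.hom.comp ((e p.1).toHom.comp p.2.toHom),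
      Subgraph.hom_injective.comp ((e p.1).injective.comp p.2.injective)⟩
  have hF (p) : (F p).toSubgraph = p.1.1 := by
    simp [F, Copy.toSubgraph, Subgraph.map_comp]
  refine Nat.card_congr (Equiv.ofBijective (fun p => ⟨F p, ?_⟩) ⟨?_, ?_⟩)
  · show P _
    rw [hF]; exact p.1.2.2
  · intro p q h
    have h' : F p = F q := congrArg Subtype.val h
    have h1 : p.1 = q.1 := Subtype.ext (by rw [← hF p, ← hF q, h'])
    obtain ⟨S, φ⟩ := p
    obtain ⟨S', ψ⟩ := q
    obtain rfl : S = S' := h1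
    congr 1
    ext a
    have h2 : F (S, φ) a = F (S, ψ) a := by rw [h']
    exact (e S).injective (Subtype.ext h2)
  · rintro ⟨f, hf⟩
    let S : {S : G.Subgraph | Nonempty (T ≃g S.coe) ∧ P S} :=
      ⟨f.toSubgraph, ⟨f.isoToSubgraph⟩, hf⟩
    refine ⟨(S, f.isoToSubgraph.trans (e S).symm), Subtype.ext (Copy.ext fun a => ?_)⟩
    show ((e S ((e S).symm (f.isoToSubgraph a))) : V) = f a
    rw [(e S).apply_symm_apply]
    rfl

/-- The labelled copies of `T` in `G` all of whose edges lie in the subgraph `G'`. -/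
def copiesIn {G : SimpleGraph V} (G' : G.Subgraph) (T : SimpleGraph U) : Set (Copy T G) :=
  {f | ∀ a b, T.Adj a b → G'.Adj (f a) (f b)}

theorem copyCount_mul_card_aut [Finite U] [Fintype V] (T : SimpleGraph U) (G : SimpleGraph V) :
    G.copyCount T * Nat.card (T ≃g T) = Nat.card (Copy T G) := by
  classical
  have h := ncard_copy_toSubgraph T G fun _ => True
  rw [Set.ofPred_true, Set.ncard_univ] at h
  rw [h, copyCount]
  congr 1
  rw [← Set.ncard_coe_finset]
  congr 1
  ext S
  simp

/-- As `T` has no isolated vertices, having all edges in `G'` already forces the vertices into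
`G'.verts`. -/
theorem copyCount_coe_mul_card_aut [Finite U] [Fintype V] (T : SimpleGraph U)
    (hT : ∀ a, ∃ b, T.Adj a b) {G : SimpleGraph V} (G' : G.Subgraph) [Fintype G'.verts] :
    G'.coe.copyCount T * Nat.card (T ≃g T) = (copiesIn G' T).ncard := by
  classical
  rw [copyCount_mul_card_aut, ← Nat.card_coe_set_eq]
  refine Nat.card_congr ⟨fun f => ⟨G'.coeCopy.comp f, fun a b h => ?_⟩,
    fun f => ⟨⟨fun a => ⟨f.1 a, ?_⟩, fun {a b} h => f.2 a b h⟩, fun a b h => ?_⟩,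
    fun f => ?_, fun f => ?_⟩
  · exact f.toHom.map_adj h
  · obtain ⟨b, hb⟩ := hT a
    exact G'.edge_vert (f.2 a b hb)
  · exact f.1.injective (congrArg Subtype.val h)
  · rfl
  · rfl

theorem le_genEx [Fintype V] {G : SimpleGraph V} (T : SimpleGraph U) (H : SimpleGraph W)
    (G' : G.Subgraph) [Fintype G'.verts] (h : H.Free G'.coe) :
    G'.coe.copyCount T ≤ genEx G T H := by
  classical
  unfold genEx
  have hm : G' ∈ Finset.univ.filter fun G' : G.Subgraph => H.Free G'.coe :=
    Finset.mem_filter.2 ⟨Finset.mem_univ G', h⟩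
  refine le_trans (le_of_eq ?_) (Finset.le_sup (f := fun G' : G.Subgraph => G'.coe.copyCount T) hm)
  convert rfl

theorem exists_genEx_eq [Fintype V] (G : SimpleGraph V) (T : SimpleGraph U) (H : SimpleGraph W)
    (hpos : genEx G T H ≠ 0) :
    ∃ G' : G.Subgraph, ∃ _ : Fintype G'.verts, H.Free G'.coe ∧
      G'.coe.copyCount T = genEx G T H := by
  classical
  unfold genEx at hpos ⊢
  set s := (Finset.univ.filter fun G' : G.Subgraph => H.Free G'.coe) with hs
  have hne : s.Nonempty := by
    rw [Finset.nonempty_iff_ne_empty]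
    intro h
    simp [h] at hpos
  obtain ⟨G', hG', h⟩ := Finset.exists_mem_eq_sup s hne fun G' => G'.coe.copyCount T
  exact ⟨G', inferInstance, (Finset.mem_filter.1 hG').2, h.symm⟩

instance card_aut_pos [Finite U] (T : SimpleGraph U) : NeZero (Nat.card (T ≃g T)) :=
  ⟨Nat.card_ne_zero.2 ⟨⟨Iso.refl⟩, inferInstance⟩⟩

/-- The density of an `H`-free subgraph, in terms of labelled copies, bounds the generalized
Turán density from below. -/
theorem le_genTuranDensity [Finite U] [Fintype V] {G : SimpleGraph V} (T : SimpleGraph U)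
    (hT : ∀ a, ∃ b, T.Adj a b) (H : SimpleGraph W) (G' : G.Subgraph) (h : H.Free G'.coe) :
    ((copiesIn G' T).ncard : ℝ) / Nat.card (Copy T G) ≤ genTuranDensity G T H := by
  classical
  have hA : (Nat.card (T ≃g T) : ℝ) ≠ 0 := Nat.cast_ne_zero.2 (NeZero.ne _)
  unfold genTuranDensity
  rw [← copyCount_mul_card_aut, ← copyCount_coe_mul_card_aut T hT, Nat.cast_mul, Nat.cast_mul,
    mul_div_mul_right _ _ hA]
  gcongr
  exact_mod_cast le_genEx T H G' h

theorem genTuranDensity_le [Finite U] [Fintype V] {G : SimpleGraph V} (T : SimpleGraph U)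
    (hT : ∀ a, ∃ b, T.Adj a b) (H : SimpleGraph W) {c : ℝ} (hc : 0 ≤ c)
    (hG : ∀ G' : G.Subgraph, H.Free G'.coe →
      ((copiesIn G' T).ncard : ℝ) ≤ c * Nat.card (Copy T G)) :
    genTuranDensity G T H ≤ c := by
  classical
  have hA : 0 < (Nat.card (T ≃g T) : ℝ) := Nat.cast_pos.2 (Nat.pos_of_ne_zero (NeZero.ne _))
  unfold genTuranDensity
  refine div_le_of_le_mul₀ (Nat.cast_nonneg _) hc ?_
  -- The supremum of an empty family is `0`, so a maximizer is extracted only when `genEx` is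
  -- nonzero.
  by_cases h0 : genEx G T H = 0
  · rw [h0, Nat.cast_zero]; positivity
  obtain ⟨G', _, hfree, h⟩ := exists_genEx_eq G T H h0
  have := hG G' hfree
  rw [← copyCount_mul_card_aut, ← copyCount_coe_mul_card_aut T hT, h, Nat.cast_mul, Nat.cast_mul,
    ← mul_assoc] at this
  exact le_of_mul_le_mul_right this hA

end SimpleGraph

/-! ### Bit flips and adjacency in the cube -/

/-- Flip the `i`-th bit of `x`. -/
def flipBit {n : ℕ} (x : Fin n → Bool) (i : Fin n) : Fin n → Bool :=
  Function.update x i (!x i)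

section FlipBit

variable {n : ℕ} (x : Fin n → Bool) (i j : Fin n)

@[simp] theorem flipBit_self : flipBit x i i = !x i := by simp [flipBit]

theorem flipBit_of_ne {i j : Fin n} (h : j ≠ i) : flipBit x i j = x j := by simp [flipBit, h]

theorem flipBit_apply : flipBit x i j = if j = i then !x j else x j := by
  split_ifs with h
  · rw [h, flipBit_self]
  · rw [flipBit_of_ne x h]

@[simp] theorem flipBit_flipBit : flipBit (flipBit x i) i = x := by
  ext m; simp only [flipBit_apply]; split_ifs <;> simp

theorem hypercube_adj_iff {x y : Fin n → Bool} :
    (hypercube n).Adj x y ↔ ∃ i, y = flipBit x i := by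
  show hammingDist x y = 1 ↔ _
  rw [hammingDist, Finset.card_eq_one]
  refine exists_congr fun i => ?_
  rw [Finset.ext_iff]
  simp only [Finset.mem_filter, Finset.mem_univ, true_and, Finset.mem_singleton]
  constructor
  · intro h
    ext m
    rw [flipBit_apply]
    split_ifs with hm
    · have := (h m).2 hm
      revert this; cases x m <;> cases y m <;> simp
    · have := mt (h m).1 hm
      simpa [eq_comm] using this
  · rintro rfl m
    rw [flipBit_apply]
    split_ifs with hm <;> simp [hm]

theorem hypercube_adj_flipBit : (hypercube n).Adj x (flipBit x i) :=
  hypercube_adj_iff.2 ⟨i, rfl⟩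

theorem hammingDist_flipBit {x y : Fin n → Bool} {i : Fin n} (h : x i ≠ y i) :
    hammingDist x (flipBit y i) + 1 = hammingDist x y := by
  unfold hammingDist
  have : (Finset.univ.filter fun m => x m ≠ flipBit y i m) =
      (Finset.univ.filter fun m => x m ≠ y m).erase i := by
    ext m
    simp only [Finset.mem_filter, Finset.mem_univ, true_and, Finset.mem_erase, flipBit_apply]
    split_ifs with hm
    · subst hm
      revert h; cases x m <;> cases y m <;> simp
    · simp [hm]
  rw [this, Finset.card_erase_add_one]
  simpa using h

end FlipBit

/-! ### Weights, and the levels met by a copy of `Q_k` -/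

section Weight

variable {n : ℕ}

/-- The set of coordinates at which `x` is `1`. -/
def bitSupport (x : Fin n → Bool) : Finset (Fin n) := Finset.univ.filter fun i => x i = true

/-- The Hamming weight of `x`. -/
def bitWeight (x : Fin n → Bool) : ℕ := (bitSupport x).card

theorem mem_bitSupport {x : Fin n → Bool} {i : Fin n} : i ∈ bitSupport x ↔ x i = true := by
  simp [bitSupport]

theorem bitSupport_injective : Function.Injective (bitSupport (n := n)) := by
  intro x y h
  ext i
  have := Finset.ext_iff.1 h i
  rw [mem_bitSupport, mem_bitSupport] at this
  exact Bool.eq_iff_iff.2 this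

theorem bitSupport_flipBit_of_false {x : Fin n → Bool} {i : Fin n} (h : x i = false) :
    bitSupport (flipBit x i) = insert i (bitSupport x) := by
  ext m
  rw [mem_bitSupport, Finset.mem_insert, mem_bitSupport, flipBit_apply]
  split_ifs with hm
  · simp [hm, h]
  · simp [hm]

theorem bitWeight_flipBit_of_false {x : Fin n → Bool} {i : Fin n} (h : x i = false) :
    bitWeight (flipBit x i) = bitWeight x + 1 := by
  rw [bitWeight, bitSupport_flipBit_of_false h, Finset.card_insert_of_notMem, bitWeight]
  simp [mem_bitSupport, h]

theorem bitWeight_flipBit_of_true {x : Fin n → Bool} {i : Fin n} (h : x i = true) :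
    bitWeight (flipBit x i) + 1 = bitWeight x := by
  rw [← bitWeight_flipBit_of_false (x := flipBit x i) (i := i) (by simp [h]), flipBit_flipBit]

theorem bitWeight_of_adj {x y : Fin n → Bool} (h : (hypercube n).Adj x y) :
    bitWeight y = bitWeight x + 1 ∨ bitWeight x = bitWeight y + 1 := by
  obtain ⟨i, rfl⟩ := hypercube_adj_iff.1 h
  cases hx : x i
  · exact .inl (bitWeight_flipBit_of_false hx)
  · exact .inr (bitWeight_flipBit_of_true hx).symm

theorem bitSupport_subset_of_adj {x y : Fin n → Bool} (h : (hypercube n).Adj x y)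
    (hw : bitWeight y = bitWeight x + 1) : bitSupport x ⊆ bitSupport y := by
  obtain ⟨i, rfl⟩ := hypercube_adj_iff.1 h
  cases hx : x i
  · rw [bitSupport_flipBit_of_false hx]
    exact Finset.subset_insert _ _
  · have := bitWeight_flipBit_of_true hx
    omega

/-- Two distinct vertices of the same weight have at most one common lower neighbour. -/
theorem common_lower_neighbor_unique {x y u v : Fin n → Bool} (hxy : x ≠ y) {w : ℕ}
    (hx : bitWeight x = w + 1) (hy : bitWeight y = w + 1)
    (hu : bitWeight u = w) (hv : bitWeight v = w)
    (hux : (hypercube n).Adj u x) (huy : (hypercube n).Adj u y)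
    (hvx : (hypercube n).Adj v x) (hvy : (hypercube n).Adj v y) : u = v := by
  -- The support of a common lower neighbour has `w` elements and lies in this intersection, hence
  -- equals it.
  have hcard : (bitSupport x ∩ bitSupport y).card ≤ w := by
    by_contra! h
    have h1 := Finset.eq_of_subset_of_card_le
      (Finset.inter_subset_left (s₁ := bitSupport x) (s₂ := bitSupport y))
      (by rw [bitWeight] at hx; omega)
    have h2 := Finset.eq_of_subset_of_card_le
      (Finset.inter_subset_right (s₁ := bitSupport x) (s₂ := bitSupport y))
      (by rw [bitWeight] at hy; omega)
    exact hxy (bitSupport_injective (h1.symm.trans h2))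
  have key : ∀ z, bitWeight z = w → (hypercube n).Adj z x → (hypercube n).Adj z y →
      bitSupport z = bitSupport x ∩ bitSupport y := fun z hz hzx hzy =>
    Finset.eq_of_subset_of_card_le
      (Finset.subset_inter (bitSupport_subset_of_adj hzx (by omega))
        (bitSupport_subset_of_adj hzy (by omega)))
      (by rw [bitWeight] at hz; omega)
  exact bitSupport_injective ((key u hu hux huy).trans (key v hv hvx hvy).symm)

/-- In a copy of `Q_k`, weights grow with the distance from a vertex of minimal weight. -/
theorem bitWeight_copy {k : ℕ} (φ : SimpleGraph.Copy (hypercube k) (hypercube n))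
    (x : Fin k → Bool) (hx : ∀ y, bitWeight (φ x) ≤ bitWeight (φ y)) (d : ℕ) :
    ∀ y, hammingDist x y = d → bitWeight (φ y) = bitWeight (φ x) + d := by
  induction d using Nat.strong_induction_on with
  | _ d ih =>
  intro y hy
  have hadj (z i) : (hypercube n).Adj (φ z) (φ (flipBit z i)) :=
    φ.toHom.map_adj (hypercube_adj_flipBit z i)
  rcases d with _ | d
  · rw [hammingDist_eq_zero] at hy
    rw [hy, add_zero]
  obtain ⟨i, hi⟩ : ∃ i, x i ≠ y i := by
    by_contra! h
    rw [show x = y from funext h, hammingDist_self] at hy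
    omega
  have hyi : hammingDist x (flipBit y i) = d := by
    have := hammingDist_flipBit hi; omega
  have hwi := ih d (by omega) _ hyi
  rcases bitWeight_of_adj (hadj y i) with h | h
  swap
  · omega
  -- If `φ y` lay below the image of its neighbour closer to `x`, either it would undercut the
  -- minimum, or `y` and `y` flipped at two coordinates `i`, `j` would both map to common lower
  -- neighbours of the images of the two single flips, contradicting uniqueness.
  exfalso
  rcases d with _ | d
  · have := hx y; omega
  obtain ⟨j, hj⟩ : ∃ j, x j ≠ flipBit y i j := by
    by_contra! h
    rw [show x = flipBit y i from funext h, hammingDist_self] at hyi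
    omega
  have hij : j ≠ i := by
    rintro rfl
    rw [flipBit_self] at hj
    revert hi hj; cases x j <;> cases y j <;> simp
  have hj' : x j ≠ y j := by rwa [flipBit_of_ne _ hij] at hj
  have hyj : hammingDist x (flipBit y j) = d + 1 := by
    have := hammingDist_flipBit hj'; omega
  have hwj := ih (d + 1) (by omega) _ hyj
  have hyij : hammingDist x (flipBit (flipBit y i) j) = d := by
    have := hammingDist_flipBit hj; omega
  have hwij := ih d (by omega) _ hyij
  have hcomm : flipBit (flipBit y i) j = flipBit (flipBit y j) i := by
    ext m; simp only [flipBit_apply]; split_ifs <;> rfl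
  have hne : flipBit y i ≠ flipBit y j := by
    intro h
    have := congrFun h i
    rw [flipBit_self, flipBit_of_ne _ hij.symm] at this
    revert this; cases y i <;> simp
  have heq : φ y = φ (flipBit (flipBit y i) j) :=
    common_lower_neighbor_unique (fun h => hne (φ.injective h)) (w := bitWeight (φ x) + d)
      (by omega) (by omega) (by omega) (by omega) (hadj y i) (hadj y j) (hadj _ j).symm
      (by rw [hcomm]; exact (hadj _ i).symm)
  have := congrFun (φ.injective heq) i
  rw [flipBit_of_ne _ hij.symm, flipBit_self] at this
  revert this; cases y i <;> simp

/-- Every copy of `Q_k` has an edge at a level congruent to `r` modulo `k`. -/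
theorem exists_edge_level_copy {k : ℕ} (φ : SimpleGraph.Copy (hypercube k) (hypercube n)) {r : ℕ}
    (hr : r < k) : ∃ a b, (hypercube k).Adj a b ∧
      min (bitWeight (φ a)) (bitWeight (φ b)) % k = r := by
  obtain ⟨x, hx⟩ := Finite.exists_min fun y => bitWeight (φ y)
  set w := bitWeight (φ x)
  obtain ⟨d, hd, hdr⟩ : ∃ d < k, (w + d) % k = r := by
    refine ⟨(r + (k - w % k)) % k, Nat.mod_lt _ (by omega), ?_⟩
    have hw := Nat.mod_lt w (show k > 0 by omega)
    rw [Nat.add_mod_mod, ← Nat.mod_add_mod,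
      show w % k + (r + (k - w % k)) = r + k by omega, Nat.add_mod_right, Nat.mod_eq_of_lt hr]
  -- A shortest path from `x` to its antipode; its step from `d` to `d + 1` is an edge at level `w +
  -- d`.
  let y (d : ℕ) : Fin k → Bool := fun i => if (i : ℕ) < d then !x i else x i
  have hy (d : ℕ) (hd : d ≤ k) : hammingDist x (y d) = d := by
    unfold hammingDist
    have : (Finset.univ.filter fun i => x i ≠ y d i) = Finset.univ.filter fun i : Fin k =>
        (i : ℕ) < d := by
      ext i
      simp only [Finset.mem_filter, Finset.mem_univ, true_and, y]
      split_ifs with h <;> simp [h]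
    rw [this, Fin.card_filter_val_lt]
    omega
  refine ⟨y d, y (d + 1), hypercube_adj_iff.2 ⟨⟨d, hd⟩, ?_⟩, ?_⟩
  · ext m
    rw [flipBit_apply]
    simp only [y, Fin.ext_iff]
    split_ifs <;> first | omega | simp
  · rw [bitWeight_copy φ x hx _ _ (hy d hd.le), bitWeight_copy φ x hx _ _ (hy (d + 1) hd),
      min_eq_left (by omega), hdr]

end Weight

/-! ### Automorphisms and subcubes -/

section Automorphism

variable {n : ℕ}

/-- The automorphism of the hypercube that permutes the coordinates and adds `a`. -/
def hypercubeAut (σ : Equiv.Perm (Fin n)) (a : Fin n → Bool) : hypercube n ≃g hypercube n where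
  toFun x m := xor (x (σ m)) (a m)
  invFun x m := xor (x (σ.symm m)) (a (σ.symm m))
  left_inv x := by ext m; simp
  right_inv x := by ext m; simp
  map_rel_iff' {x y} := by
    show hammingDist _ _ = 1 ↔ hammingDist _ _ = 1
    have : hammingDist (fun m => xor (x (σ m)) (a m)) (fun m => xor (y (σ m)) (a m)) =
        hammingDist x y := by
      unfold hammingDist
      refine Finset.card_equiv σ fun i => ?_
      simp
    exact iff_of_eq (congrArg (· = 1) this)

/-- The automorphism group of the hypercube is transitive on oriented edges. -/
theorem exists_aut_of_adj {x y x' y' : Fin n → Bool} (h : (hypercube n).Adj x y)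
    (h' : (hypercube n).Adj x' y') : ∃ g : hypercube n ≃g hypercube n, g x = x' ∧ g y = y' := by
  obtain ⟨i, rfl⟩ := hypercube_adj_iff.1 h
  obtain ⟨i', rfl⟩ := hypercube_adj_iff.1 h'
  -- The transposition matches the two directions, and the translation then carries `x` to `x'`.
  refine ⟨hypercubeAut (Equiv.swap i i') fun m => xor (x (Equiv.swap i i' m)) (x' m), ?_, ?_⟩
  · ext m
    show xor _ (xor _ _) = _
    simp
  · ext m
    show xor (flipBit x i _) (xor _ _) = _
    rw [flipBit_apply, flipBit_apply]
    have : Equiv.swap i i' m = i ↔ m = i' := by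
      rw [Equiv.swap_apply_eq_iff, Equiv.swap_apply_left]
    simp only [this]
    split_ifs <;> simp

/-- The embedding of `Q_a` as a subcube of `Q_b` spanned by the coordinates in the range of `e`,
with the remaining coordinates fixed as in `x`. -/
noncomputable def subcubeCopy {a b : ℕ} (e : Fin a ↪ Fin b) (x : Fin b → Bool) :
    SimpleGraph.Copy (hypercube a) (hypercube b) where
  toHom :=
    { toFun w := Function.extend e w x
      map_rel' := by
        intro w w' h
        obtain ⟨i, rfl⟩ := hypercube_adj_iff.1 h
        refine hypercube_adj_iff.2 ⟨e i, ?_⟩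
        ext m
        rw [flipBit_apply]
        by_cases hm : ∃ j, e j = m
        · obtain ⟨j, rfl⟩ := hm
          rw [e.injective.extend_apply, e.injective.extend_apply, flipBit_apply]
          simp [e.injective.eq_iff]
        · rw [Function.extend_apply' _ _ _ hm, Function.extend_apply' _ _ _ hm, if_neg]
          rintro rfl
          exact hm ⟨i, rfl⟩ }
  injective' := by
    intro w w' h
    ext j
    have := congrFun h (e j)
    change Function.extend e w x (e j) = Function.extend e w' x (e j) at this
    rwa [e.injective.extend_apply, e.injective.extend_apply] at this

theorem subcubeCopy_apply {a b : ℕ} (e : Fin a ↪ Fin b) (x : Fin b → Bool) (w : Fin a → Bool) :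
    subcubeCopy e x w = Function.extend e w x := rfl

end Automorphism

open SimpleGraph

/-! ### Upper bound by averaging over automorphisms -/

section Averaging

variable {n : ℕ} (G' : (hypercube n).Subgraph)

/-- A copy of `Q_k` contains an edge outside a `Q_k`-free subgraph. -/
theorem exists_missing_edge_of_free {k : ℕ} (hk : 1 ≤ k) (hG' : (hypercube k).Free G'.coe)
    (ψ : Copy (hypercube k) (hypercube n)) :
    ∃ w i, ¬ G'.Adj (ψ w) (ψ (flipBit w i)) := by
  by_contra! h
  refine hG' ⟨⟨⟨fun w => ⟨ψ w, G'.edge_vert (h w ⟨0, hk⟩)⟩, fun {a b} hab => ?_⟩,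
    fun a b hab => ψ.injective (congrArg Subtype.val hab)⟩⟩
  obtain ⟨i, rfl⟩ := hypercube_adj_iff.1 hab
  exact h a i

/-- In a copy of `Q_{k+2}`, the endpoints of the edges missing from a `Q_k`-free subgraph separate
the coordinates. -/
theorem le_two_pow_card_missing {k : ℕ} (hk : 1 ≤ k) (hG' : (hypercube k).Free G'.coe)
    (φ : Copy (hypercube (k + 2)) (hypercube n)) (S : Finset (Fin (k + 2) → Bool))
    (hS : ∀ x i, ¬ G'.Adj (φ x) (φ (flipBit x i)) → x ∈ S) : k + 2 ≤ 2 ^ S.card := by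
  let sep (i : Fin (k + 2)) (x : S) : Bool := x.1 i
  have hsep : Function.Injective sep := by
    intro i j hij
    by_contra hne
    have hcard : Fintype.card (Fin k) ≤ Fintype.card {m : Fin (k + 2) // m ≠ i ∧ m ≠ j} := by
      rw [Fintype.card_subtype, Fintype.card_fin]
      have : (Finset.univ.filter fun m : Fin (k + 2) => m ≠ i ∧ m ≠ j) =
          (Finset.univ.erase j).erase i := by
        ext m; simp
      rw [this, Finset.card_erase_of_mem (by simpa using hne),
        Finset.card_erase_of_mem (Finset.mem_univ _)]
      simp
    obtain ⟨e⟩ := Function.Embedding.nonempty_of_card_le hcard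
    let e' : Fin k ↪ Fin (k + 2) := e.trans (Function.Embedding.subtype _)
    -- The subcube has `x_i = 0` and `x_j = 1`, so any point of `S` in it separates `i` from `j`.
    let x₀ : Fin (k + 2) → Bool := fun m => decide (m = j)
    obtain ⟨w, a, h⟩ := exists_missing_edge_of_free G' hk hG' (φ.comp (subcubeCopy e' x₀))
    have hadj := (subcubeCopy e' x₀).toHom.map_adj (hypercube_adj_flipBit w a)
    obtain ⟨b, hb⟩ := hypercube_adj_iff.1 hadj
    have hmem : subcubeCopy e' x₀ w ∈ S := by
      refine hS _ b ?_
      rw [Copy.toHom_apply, Copy.toHom_apply] at hb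
      rwa [← hb]
    have h2 := congrFun hij ⟨_, hmem⟩
    have hi : ¬ ∃ a, e' a = i := by
      rintro ⟨a, ha⟩; exact (e a).2.1 ha
    have hj : ¬ ∃ a, e' a = j := by
      rintro ⟨a, ha⟩; exact (e a).2.2 ha
    simp only [sep, subcubeCopy_apply, Function.extend_apply' _ _ _ hi,
      Function.extend_apply' _ _ _ hj, x₀] at h2
    simp [hne] at h2
  have := Fintype.card_le_of_injective sep hsep
  simpa using this

open Classical in
/-- The number of automorphisms mapping a given edge outside `G'` does not depend on the edge. -/
theorem card_aut_missing_eq [Fintype (hypercube n ≃g hypercube n)] {x y x' y' : Fin n → Bool}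
    (h : (hypercube n).Adj x y) (h' : (hypercube n).Adj x' y') :
    (Finset.univ.filter fun g : hypercube n ≃g hypercube n => ¬ G'.Adj (g x') (g y')).card =
      (Finset.univ.filter fun g : hypercube n ≃g hypercube n => ¬ G'.Adj (g x) (g y)).card := by
  obtain ⟨g₀, rfl, rfl⟩ := exists_aut_of_adj h h'
  refine Finset.card_bij' (fun g _ => g₀.trans g) (fun g _ => g₀.symm.trans g) ?_ ?_ ?_ ?_
  · intro g; simp
  · intro g; simp
  · intro g _; ext x : 1; simp
  · intro g _; ext x : 1; simp

/-- The average over all automorphisms: the proportion of edges missing from `G'` is at most the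
proportion of copies of `T` missing from `G'`. -/
theorem card_aut_missing_mul_le {U : Type*} [Finite U] (T : SimpleGraph U) {a₀ b₀ : U}
    (hT : T.Adj a₀ b₀) {x y : Fin n → Bool} (h : (hypercube n).Adj x y) :
    {g : hypercube n ≃g hypercube n | ¬ G'.Adj (g x) (g y)}.ncard *
        Nat.card (Copy T (hypercube n)) ≤
      Nat.card (hypercube n ≃g hypercube n) * (copiesIn G' T)ᶜ.ncard := by
  classical
  let _ := Fintype.ofFinite (hypercube n ≃g hypercube n)
  let _ := Fintype.ofFinite (Copy T (hypercube n))
  let act (g : hypercube n ≃g hypercube n) (f : Copy T (hypercube n)) : Copy T (hypercube n) :=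
    g.toCopy.comp f
  -- Double counting of pairs `(f, g)` with `g ∘ f` lost: each `g` permutes the copies, while for
  -- each `f` it suffices that `g` sends the edge `f a₀`, `f b₀` outside `G'`.
  have h1 := Finset.sum_card_bipartiteAbove_eq_sum_card_bipartiteBelow
    (s := (Finset.univ : Finset (Copy T (hypercube n))))
    (t := (Finset.univ : Finset (hypercube n ≃g hypercube n)))
    (fun f g => act g f ∉ copiesIn G' T)
  have h2 (g : hypercube n ≃g hypercube n) :
      (Finset.bipartiteBelow (fun f g => act g f ∉ copiesIn G' T) Finset.univ g).card =
        (copiesIn G' T)ᶜ.ncard := by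
    rw [← Set.ncard_coe_finset]
    refine Set.ncard_congr (fun f _ => act g f) ?_ ?_ ?_
    · intro f hf
      simpa [Finset.bipartiteBelow] using hf
    · intro f f' _ _ hff
      ext a : 1
      have : g (f a) = g (f' a) := DFunLike.congr_fun hff a
      exact g.injective this
    · intro f hf
      have : act g (act g.symm f) = f := by
        ext a : 1
        show g (g.symm (f a)) = f a
        simp
      refine ⟨act g.symm f, ?_, this⟩
      simpa [Finset.bipartiteBelow, this] using hf
  have h3 (f : Copy T (hypercube n)) :
      {g : hypercube n ≃g hypercube n | ¬ G'.Adj (g x) (g y)}.ncard ≤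
      (Finset.bipartiteAbove (fun f g => act g f ∉ copiesIn G' T) Finset.univ f).card := by
    rw [Set.ncard_eq_toFinset_card', Set.toFinset_ofPred,
      ← card_aut_missing_eq G' h (f.toHom.map_adj hT)]
    refine Finset.card_le_card fun g hg => ?_
    simp only [Finset.mem_filter, Finset.mem_univ, true_and, Finset.bipartiteAbove] at hg ⊢
    exact fun hmem => hg (hmem _ _ hT)
  rw [Finset.sum_congr rfl fun g _ => h2 g, Finset.sum_const, Finset.card_univ, smul_eq_mul,
    ← Nat.card_eq_fintype_card] at h1
  rw [← h1, mul_comm, Nat.card_eq_fintype_card, ← Finset.card_univ, ← smul_eq_mul]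
  exact Finset.card_nsmul_le_sum _ _ _ fun f _ => h3 f

/-- The proportion of edges missing from a `Q_k`-free subgraph of `Q_n`. -/
theorem logb_mul_card_aut_le {k : ℕ} (hk : 1 ≤ k) (hn : k + 2 ≤ n)
    (hG' : (hypercube k).Free G'.coe) {x y : Fin n → Bool} (h : (hypercube n).Adj x y) :
    Real.logb 2 (k + 2) * Nat.card (hypercube n ≃g hypercube n) ≤
      (k + 2) * 2 ^ (k + 2) *
        {g : hypercube n ≃g hypercube n | ¬ G'.Adj (g x) (g y)}.ncard := by
  classical
  let _ := Fintype.ofFinite (hypercube n ≃g hypercube n)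
  let ι := subcubeCopy (Fin.castLEEmb hn) fun _ => false
  let R (p : (Fin (k + 2) → Bool) × Fin (k + 2)) (g : hypercube n ≃g hypercube n) : Prop :=
    ¬ G'.Adj (g (ι p.1)) (g (ι (flipBit p.1 p.2)))
  -- Pairs of an oriented edge of one fixed `Q_{k+2}` and an automorphism sending it outside `G'`.
  -- There are `(k + 2) * 2 ^ (k + 2)` oriented edges.
  have h1 := Finset.sum_card_bipartiteAbove_eq_sum_card_bipartiteBelow
    (s := Finset.univ) (t := Finset.univ) R
  have h2 (p) : (Finset.bipartiteAbove R Finset.univ p).card =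
      {g : hypercube n ≃g hypercube n | ¬ G'.Adj (g x) (g y)}.ncard := by
    rw [Set.ncard_eq_toFinset_card', Set.toFinset_ofPred,
      ← card_aut_missing_eq G' h (ι.toHom.map_adj (hypercube_adj_flipBit p.1 p.2))]
    rfl
  have h3 (g : hypercube n ≃g hypercube n) :
      Real.logb 2 (k + 2) ≤ (Finset.bipartiteBelow R Finset.univ g).card := by
    have := le_two_pow_card_missing G' hk hG' (g.toCopy.comp ι)
      ((Finset.bipartiteBelow R Finset.univ g).image Prod.fst) (by
        intro x i hx
        exact Finset.mem_image.2 ⟨(x, i), by simpa [Finset.bipartiteBelow, R] using hx, rfl⟩)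
    have h4 : k + 2 ≤ 2 ^ (Finset.bipartiteBelow R Finset.univ g).card :=
      this.trans (Nat.pow_le_pow_right (by norm_num) Finset.card_image_le)
    rw [Real.logb_le_iff_le_rpow (by norm_num) (by positivity), Real.rpow_natCast]
    exact_mod_cast h4
  rw [Finset.sum_congr rfl fun g _ => h2 g, Finset.sum_const, Finset.card_univ,
    Fintype.card_prod, Fintype.card_pi, smul_eq_mul] at h1
  simp only [Fintype.card_bool, Finset.prod_const, Finset.card_univ, Fintype.card_fin] at h1
  have h5 : ((2 ^ (k + 2) * (k + 2) *
      {g : hypercube n ≃g hypercube n | ¬ G'.Adj (g x) (g y)}.ncard : ℕ) : ℝ) =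
      ∑ g, ((Finset.bipartiteBelow R Finset.univ g).card : ℝ) := by
    rw [h1]; push_cast; rfl
  have h6 := Finset.card_nsmul_le_sum Finset.univ
    (fun g => ((Finset.bipartiteBelow R Finset.univ g).card : ℝ)) _ fun g _ => h3 g
  rw [← h5, nsmul_eq_mul, Finset.card_univ, ← Nat.card_eq_fintype_card] at h6
  push_cast at h6
  linarith

/-- The upper bound on the generalized Turán density of `Q_k` in the hypercube. -/
theorem genTuranDensity_hypercube_le {U : Type*} [Finite U] [Nonempty U] (T : SimpleGraph U)
    (hT : ∀ a, ∃ b, T.Adj a b) {k : ℕ} (hk : 2 ≤ k) (hn : k + 2 ≤ n) :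
    genTuranDensity (hypercube n) T (hypercube k) ≤
      1 - 1 / 8 * (Real.log k / (k * 2 ^ k)) := by
  have hk0 : (2 : ℝ) ≤ k := by exact_mod_cast hk
  have hlog0 : 0 < Real.log k := Real.log_pos (by linarith)
  have hlog : Real.log k ≤ Real.logb 2 (k + 2) := by
    have h2 : Real.log 2 ≤ 1 := by linarith [Real.log_two_lt_d9]
    have h1 : Real.log k ≤ Real.log (k + 2) := Real.log_le_log (by linarith) (by linarith)
    rw [Real.logb, le_div_iff₀ (Real.log_pos (by norm_num))]
    nlinarith
  have hlogk : Real.log k ≤ k := (Real.log_le_sub_one_of_pos (by linarith)).trans (by linarith)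
  have hpow : (1 : ℝ) ≤ 2 ^ k := one_le_pow₀ (by norm_num)
  refine genTuranDensity_le T hT _ ?_ fun G' hG' => ?_
  · have : Real.log k / (k * 2 ^ k) ≤ 1 := by
      rw [div_le_one (by positivity)]
      nlinarith
    linarith
  obtain ⟨a₀⟩ := ‹Nonempty U›
  obtain ⟨b₀, hab⟩ := hT a₀
  have hxy := hypercube_adj_flipBit (fun _ : Fin n => false) ⟨0, by omega⟩
  have h1 := card_aut_missing_mul_le G' T hab hxy
  have h2 := logb_mul_card_aut_le G' (by omega) hn hG' hxy
  have h3 := Set.ncard_add_ncard_compl (copiesIn G' T)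
  set c := {g : hypercube n ≃g hypercube n | ¬ G'.Adj _ _}.ncard
  set L := Nat.card (Copy T (hypercube n))
  set N := Nat.card (hypercube n ≃g hypercube n) with hN
  set B := (copiesIn G' T)ᶜ.ncard
  have hN0 : (0 : ℝ) < N := Nat.cast_pos.2 (Nat.pos_of_ne_zero (NeZero.ne _))
  have h1' : (c : ℝ) * L ≤ N * B := by exact_mod_cast h1
  have h3' : ((copiesIn G' T).ncard : ℝ) = L - B := by
    rw [eq_sub_iff_add_eq]; exact_mod_cast h3
  rw [h3', sub_mul, one_mul]
  refine sub_le_sub_left ?_ _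
  -- The factor `8` comes from `k + 2 ≤ 2 * k` and `2 ^ (k + 2) = 4 * 2 ^ k`.
  have h4 : Real.log k * N ≤ 8 * (k * 2 ^ k) * c :=
    calc Real.log k * N ≤ Real.logb 2 (k + 2) * N := by gcongr
      _ ≤ (k + 2) * 2 ^ (k + 2) * c := h2
      _ ≤ (2 * k) * 2 ^ (k + 2) * c := by gcongr; linarith
      _ = _ := by ring
  have h5 : 1 / 8 * (Real.log k / (k * 2 ^ k)) * N ≤ c := by
    rw [← mul_div_assoc, div_mul_eq_mul_div, div_le_iff₀ (by positivity)]
    linarith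
  refine le_of_mul_le_mul_left ?_ hN0
  calc N * (1 / 8 * (Real.log k / (k * 2 ^ k)) * L)
      = (1 / 8 * (Real.log k / (k * 2 ^ k)) * N) * L := by ring
    _ ≤ c * L := by gcongr
    _ ≤ N * B := h1'

end Averaging

/-! ### Cycle graphs and their automorphisms -/

section Cycle

/-- Replaces subtraction modulo `m` by linear conditions that `omega` can treat. -/
theorem cycleGraph_adj_iff_val {m : ℕ} (hm : 2 ≤ m) {u v : Fin m} :
    (cycleGraph m).Adj u v ↔ (v : ℕ) = u + 1 ∨ (u : ℕ) = v + 1 ∨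
      ((u : ℕ) = 0 ∧ (v : ℕ) + 1 = m) ∨ ((v : ℕ) = 0 ∧ (u : ℕ) + 1 = m) := by
  have hu := u.2
  have hv := v.2
  have key (a b : ℕ) (ha : a < m) (hb : b < m) :
      (m - b + a) % m = 1 ↔ a = b + 1 ∨ (a = 0 ∧ b + 1 = m) := by
    rcases lt_or_ge a b with h | h
    · rw [Nat.mod_eq_of_lt (by omega)]
      omega
    · rw [show m - b + a = (a - b) + m by omega, Nat.add_mod_right, Nat.mod_eq_of_lt (by omega)]
      omega
  rw [cycleGraph_adj', Fin.sub_def, Fin.sub_def, key u v hu hv, key v u hv hu]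
  tauto

/-- The cyclic successor on the vertices of a cycle. -/
def cycleSucc {m : ℕ} (a : Fin m) : Fin m :=
  if h : (a : ℕ) + 1 < m then ⟨a + 1, h⟩ else ⟨0, a.pos⟩

theorem cycleSucc_val {m : ℕ} (a : Fin m) :
    ((a : ℕ) + 1 < m ∧ (cycleSucc a : ℕ) = a + 1) ∨
      ((a : ℕ) + 1 = m ∧ (cycleSucc a : ℕ) = 0) := by
  have := a.2
  unfold cycleSucc
  split_ifs with h
  · exact .inl ⟨h, rfl⟩
  · exact .inr ⟨by omega, rfl⟩

theorem cycleGraph_adj_iff_cycleSucc {m : ℕ} (hm : 2 ≤ m) {u v : Fin m} :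
    (cycleGraph m).Adj u v ↔ v = cycleSucc u ∨ u = cycleSucc v := by
  rw [cycleGraph_adj_iff_val hm, Fin.ext_iff, Fin.ext_iff]
  have h1 := cycleSucc_val u
  have h2 := cycleSucc_val v
  omega

theorem cycleGraph_adj_cycleSucc {m : ℕ} (hm : 2 ≤ m) (u : Fin m) :
    (cycleGraph m).Adj u (cycleSucc u) :=
  (cycleGraph_adj_iff_cycleSucc hm).2 (.inl rfl)

theorem exists_cycleGraph_adj {m : ℕ} (hm : 2 ≤ m) (a : Fin m) : ∃ b, (cycleGraph m).Adj a b :=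
  ⟨_, cycleGraph_adj_cycleSucc hm a⟩

theorem cycleSucc_injective {m : ℕ} : Function.Injective (cycleSucc (m := m)) := by
  intro a b h
  have h1 := cycleSucc_val a
  have h2 := cycleSucc_val b
  rw [Fin.ext_iff] at h ⊢
  omega

/-- A rotation of a cycle. -/
def cycleRotation {m : ℕ} (hm : 2 ≤ m) : Copy (cycleGraph m) (cycleGraph m) where
  toHom :=
    { toFun := cycleSucc
      map_rel' := by
        intro a b h
        rw [cycleGraph_adj_iff_cycleSucc hm] at h ⊢
        rcases h with rfl | rfl <;> simp }
  injective' := cycleSucc_injective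

/-- A property that holds somewhere on a cycle and is preserved by the successor holds everywhere. -/
theorem cycleSucc_induction {m : ℕ} (P : Fin m → Prop) (a : Fin m) (ha : P a)
    (h : ∀ b, P b → P (cycleSucc b)) (b : Fin m) : P b := by
  have hup (s : ℕ) : ∀ c d : Fin m, (d : ℕ) = c + s → P c → P d := by
    induction s with
    | zero => rintro c d h hc; rwa [show d = c from Fin.ext h]
    | succ s ih =>
      intro c d hcd hc
      have hd := d.2
      refine ih (cycleSucc c) d ?_ (h c hc)
      have := cycleSucc_val c
      omega
  have hm := a.pos
  have hlast : P ⟨m - 1, by omega⟩ := hup (m - 1 - a) a _ (by have := a.2; simp only; omega) ha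
  have hzero : P ⟨0, hm⟩ := by
    convert h _ hlast
    have := cycleSucc_val (⟨m - 1, by omega⟩ : Fin m)
    simp only at this
    omega
  exact hup b _ _ (by simp) hzero

/-- An automorphism is determined by the image of one vertex and its sense of rotation. An upper
bound suffices, as it serves only to bound the total number of cycles from above. -/
theorem card_aut_cycleGraph_le {m : ℕ} (hm : 3 ≤ m) :
    Nat.card (cycleGraph m ≃g cycleGraph m) ≤ 2 * m := by
  classical
  let v₀ : Fin m := ⟨0, by omega⟩
  have hinj : Function.Injective fun φ : cycleGraph m ≃g cycleGraph m =>
      (φ v₀, decide (φ (cycleSucc v₀) = cycleSucc (φ v₀))) := by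
    intro φ ψ h
    rw [Prod.mk.injEq, decide_eq_decide] at h
    obtain ⟨h0, h⟩ := h
    have hadj (χ : cycleGraph m ≃g cycleGraph m) (u) :
        (cycleGraph m).Adj (χ u) (χ (cycleSucc u)) :=
      χ.map_rel_iff.2 (cycleGraph_adj_cycleSucc (by omega) u)
    have h1 : φ (cycleSucc v₀) = ψ (cycleSucc v₀) := by
      have e1 := hadj φ v₀
      have e2 := hadj ψ v₀
      rw [cycleGraph_adj_iff_cycleSucc (by omega)] at e1 e2
      rw [← h0] at h e2
      by_cases hc : φ (cycleSucc v₀) = cycleSucc (φ v₀)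
      · rw [hc, h.1 hc]
      · exact cycleSucc_injective ((e1.resolve_left hc).symm.trans
          (e2.resolve_left (fun h' => hc (h.2 h'))))
    have key (u : Fin m) : φ u = ψ u ∧ φ (cycleSucc u) = ψ (cycleSucc u) := by
      refine cycleSucc_induction (fun u => φ u = ψ u ∧ φ (cycleSucc u) = ψ (cycleSucc u)) v₀
        ⟨h0, h1⟩ (fun u hu => ⟨hu.2, ?_⟩) u
      -- The image of the next vertex must be the neighbour of the current image that is not the
      -- previous image; this uses `m ≥ 3`.
      have hne : cycleSucc (cycleSucc u) ≠ u := by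
        have a1 := cycleSucc_val u
        have a2 := cycleSucc_val (cycleSucc u)
        rw [Ne, Fin.ext_iff]
        omega
      have n1 : φ (cycleSucc (cycleSucc u)) ≠ φ u := fun h => hne (φ.injective h)
      have n2 : ψ (cycleSucc (cycleSucc u)) ≠ φ u := fun h => hne (ψ.injective (h.trans hu.1))
      have e0 := hadj φ u
      have e1 := hadj φ (cycleSucc u)
      have e2 := hadj ψ (cycleSucc u)
      rw [← hu.2] at e2
      rw [cycleGraph_adj_iff_val (by omega)] at e0 e1 e2
      rw [Ne, Fin.ext_iff] at n1 n2
      rw [Fin.ext_iff]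
      have b0 := (φ u).2
      have b1 := (φ (cycleSucc u)).2
      have b2 := (φ (cycleSucc (cycleSucc u))).2
      have b3 := (ψ (cycleSucc (cycleSucc u))).2
      omega
    ext u : 1
    exact (key u).1
  have := Nat.card_le_card_of_injective _ hinj
  rw [Nat.card_prod, Nat.card_eq_fintype_card (α := Fin m), Fintype.card_fin,
    Nat.card_eq_fintype_card (α := Bool), Fintype.card_bool] at this
  omega

end Cycle

/-! ### Removing levels modulo `k` -/

section Levels

variable {n : ℕ}

/-- The subgraph of the hypercube obtained by removing the edges whose lower endpoint has weight
congruent to `r` modulo `k`. -/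
def levelSubgraph (n k r : ℕ) : (hypercube n).Subgraph where
  verts := Set.univ
  Adj x y := (hypercube n).Adj x y ∧ min (bitWeight x) (bitWeight y) % k ≠ r
  adj_sub h := h.1
  edge_vert _ := Set.mem_univ _
  symm := ⟨fun x y h => ⟨h.1.symm, by rw [min_comm]; exact h.2⟩⟩

theorem levelSubgraph_free {k r : ℕ} (hr : r < k) :
    (hypercube k).Free (levelSubgraph n k r).coe := by
  rintro ⟨φ⟩
  obtain ⟨a, b, hab, h⟩ := exists_edge_level_copy ((levelSubgraph n k r).coeCopy.comp φ) hr
  exact (φ.toHom.map_adj hab).2 h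

/-- If the edges of every member of a family of copies lie on at most `t` levels modulo `k`, then
a proportion `1 - t / k` of the family survives in some level subgraph. -/
theorem exists_level_copies {U : Type*} [Finite U] (T : SimpleGraph U) {k t : ℕ} (hk : 0 < k)
    (X : Set (Copy T (hypercube n)))
    (hX : ∀ f ∈ X, ∃ s : Finset ℕ, s.card ≤ t ∧ ∀ a b, T.Adj a b →
      min (bitWeight (f a)) (bitWeight (f b)) % k ∈ s) :
    ∃ r < k, k * X.ncard ≤ k * (X ∩ copiesIn (levelSubgraph n k r) T).ncard + t * X.ncard := by
  classical
  let _ := Fintype.ofFinite (Copy T (hypercube n))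
  let R (f : Copy T (hypercube n)) (r : ℕ) : Prop := f ∉ copiesIn (levelSubgraph n k r) T
  -- A copy is destroyed by at most `t` of the `k` residues, so some residue destroys at most a
  -- proportion `t / k` of `X`.
  have h1 := Finset.sum_card_bipartiteAbove_eq_sum_card_bipartiteBelow
    (s := X.toFinset) (t := Finset.range k) R
  have h2 (f) (hf : f ∈ X.toFinset) : (Finset.bipartiteAbove R (Finset.range k) f).card ≤ t := by
    obtain ⟨s, hs, h⟩ := hX f (by simpa using hf)
    refine (Finset.card_le_card fun r hr => ?_).trans hs
    have hr' : f ∉ copiesIn (levelSubgraph n k r) T := (Finset.mem_filter.1 hr).2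
    simp only [copiesIn, Set.mem_ofPred_eq, not_forall] at hr'
    obtain ⟨a, b, hab, hr'⟩ := hr'
    have : min (bitWeight (f a)) (bitWeight (f b)) % k = r := by
      by_contra hne
      exact hr' ⟨f.toHom.map_adj hab, hne⟩
    exact this ▸ h a b hab
  have h3 := Finset.sum_le_card_nsmul _ _ _ h2
  rw [h1] at h3
  have h4 : ∑ r ∈ Finset.range k, k * (Finset.bipartiteBelow R X.toFinset r).card ≤
      ∑ r ∈ Finset.range k, t * X.ncard := by
    rw [← Finset.mul_sum, Finset.sum_const, Finset.card_range, smul_eq_mul,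
      Set.ncard_eq_toFinset_card', mul_comm t]
    exact Nat.mul_le_mul_left _ h3
  obtain ⟨r, hr, h5⟩ := Finset.exists_le_of_sum_le (by simpa using hk.ne') h4
  refine ⟨r, Finset.mem_range.1 hr, ?_⟩
  have h6 : (X \ copiesIn (levelSubgraph n k r) T).ncard =
      (Finset.bipartiteBelow R X.toFinset r).card := by
    rw [← Set.ncard_coe_finset]
    congr 1
    ext f
    simp [Finset.bipartiteBelow, R]
  rw [← h6] at h5
  have h7 := Set.ncard_inter_add_ncard_sdiff_eq_ncard X (copiesIn (levelSubgraph n k r) T)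
  nlinarith

/-- The weights along a closed walk of length `2 * ℓ` in the hypercube differ by at most `ℓ`. -/
theorem bitWeight_cycle_le {ℓ : ℕ} (hℓ : 1 ≤ ℓ) (f : Copy (cycleGraph (2 * ℓ)) (hypercube n))
    (a b : Fin (2 * ℓ)) : bitWeight (f b) ≤ bitWeight (f a) + ℓ := by
  have hstep (c : Fin (2 * ℓ)) := bitWeight_of_adj
    (f.toHom.map_adj (cycleGraph_adj_cycleSucc (by omega) c))
  simp only [Copy.toHom_apply] at hstep
  -- Here `d` is reached from `c` by `s` successor steps, possibly wrapping around once. The shorter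
  -- arc has `s ≤ ℓ`.
  have hlin (s : ℕ) : ∀ c d : Fin (2 * ℓ), ((d : ℕ) = c + s ∨ (d : ℕ) + 2 * ℓ = c + s) →
      bitWeight (f d) ≤ bitWeight (f c) + s ∧ bitWeight (f c) ≤ bitWeight (f d) + s := by
    induction s with
    | zero =>
      intro c d h
      have : d = c := Fin.ext (by have := d.2; have := c.2; omega)
      simp [this]
    | succ s ih =>
      intro c d h
      have h1 := cycleSucc_val c
      have hd := d.2
      have := ih (cycleSucc c) d (by omega)
      have := hstep c
      omega
  have ha := a.2
  have hb := b.2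
  rcases le_total (a : ℕ) b with h | h
  · rcases le_total ((b : ℕ) - a) ℓ with h' | h'
    · have := hlin (b - a) a b (by omega); omega
    · have := hlin (a + 2 * ℓ - b) b a (by omega); omega
  · rcases le_total ((a : ℕ) - b) ℓ with h' | h'
    · have := hlin (a - b) b a (by omega); omega
    · have := hlin (b + 2 * ℓ - a) a b (by omega); omega

/-- All weights lie between the minimum `w` and `w + ℓ`, so lower endpoints of edges take only the
`ℓ` values below `w + ℓ`. -/
theorem exists_levels_cycle {ℓ : ℕ} (hℓ : 1 ≤ ℓ) (k : ℕ)
    (f : Copy (cycleGraph (2 * ℓ)) (hypercube n)) :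
    ∃ s : Finset ℕ, s.card ≤ ℓ ∧ ∀ a b, (cycleGraph (2 * ℓ)).Adj a b →
      min (bitWeight (f a)) (bitWeight (f b)) % k ∈ s := by
  have : Nonempty (Fin (2 * ℓ)) := ⟨⟨0, by omega⟩⟩
  obtain ⟨c, hc⟩ := Finite.exists_min fun a => bitWeight (f a)
  refine ⟨(Finset.Ico (bitWeight (f c)) (bitWeight (f c) + ℓ)).image (· % k),
    Finset.card_image_le.trans (by simp), fun a b hab => Finset.mem_image_of_mem _ ?_⟩
  have h1 := bitWeight_of_adj (f.toHom.map_adj hab)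
  simp only [Copy.toHom_apply] at h1
  have := hc a
  have := hc b
  have := bitWeight_cycle_le hℓ f c a
  have := bitWeight_cycle_le hℓ f c b
  rw [Finset.mem_Ico]
  omega

/-- The lower bound `1 - ℓ / k` on the generalized Turán density. -/
theorem one_sub_le_genTuranDensity {ℓ k : ℕ} (hℓ : 2 ≤ ℓ) (hk : 0 < k)
    (hpos : Nonempty (Copy (cycleGraph (2 * ℓ)) (hypercube n))) :
    1 - (ℓ : ℝ) / k ≤ genTuranDensity (hypercube n) (cycleGraph (2 * ℓ)) (hypercube k) := by
  obtain ⟨r, hr, h⟩ := exists_level_copies (cycleGraph (2 * ℓ)) hk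
    (Set.univ : Set (Copy (cycleGraph (2 * ℓ)) (hypercube n)))
    fun f _ => exists_levels_cycle (by omega) k f
  refine le_trans ?_ (le_genTuranDensity _ (exists_cycleGraph_adj (by omega)) _ _
    (levelSubgraph_free hr))
  rw [Set.univ_inter, Set.ncard_univ] at h
  have hL : 0 < (Nat.card (Copy (cycleGraph (2 * ℓ)) (hypercube n)) : ℝ) :=
    Nat.cast_pos.2 Nat.card_pos
  have hk' : (0 : ℝ) < k := Nat.cast_pos.2 hk
  have h' : (k : ℝ) * Nat.card (Copy (cycleGraph (2 * ℓ)) (hypercube n)) ≤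
    k * (copiesIn (levelSubgraph n k r) (cycleGraph (2 * ℓ))).ncard +
      ℓ * Nat.card (Copy (cycleGraph (2 * ℓ)) (hypercube n)) := by exact_mod_cast h
  rw [le_div_iff₀ hL]
  refine le_of_mul_le_mul_left ?_ hk'
  rw [← mul_assoc, mul_sub, mul_div_cancel₀ _ hk'.ne']
  linarith

end Levels

/-! ### Zigzag cycles and their number -/

section Zigzag

variable {ℓ n : ℕ}

/-- The vertices of the zigzag cycle `{0}, {0, 1}, {1}, {1, 2}, …, {ℓ - 1}, {ℓ - 1, 0}` of `Q_ℓ`. -/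
def zigzagVertex (ℓ : ℕ) (a : Fin (2 * ℓ)) : Fin ℓ → Bool := fun j =>
  decide ((j : ℕ) = (a : ℕ) / 2 ∨
    ((a : ℕ) % 2 = 1 ∧ ((j : ℕ) = (a : ℕ) / 2 + 1 ∨ ((j : ℕ) = 0 ∧ (a : ℕ) / 2 + 1 = ℓ))))

theorem zigzagVertex_adj (hℓ : 3 ≤ ℓ) (a : Fin (2 * ℓ)) :
    (hypercube ℓ).Adj (zigzagVertex ℓ a) (zigzagVertex ℓ (cycleSucc a)) := by
  have ha := a.2
  have hs := cycleSucc_val a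
  have hflip (c : Fin ℓ) (hc : ∀ j : Fin ℓ, zigzagVertex ℓ (cycleSucc a) j =
      if j = c then !zigzagVertex ℓ a j else zigzagVertex ℓ a j) :
      (hypercube ℓ).Adj (zigzagVertex ℓ a) (zigzagVertex ℓ (cycleSucc a)) :=
    hypercube_adj_iff.2 ⟨c, funext fun j => by rw [hc, flipBit_apply]⟩
  rcases Nat.mod_two_eq_zero_or_one a with h | h
  -- From `{i}` the cyclically next coordinate enters; from a pair the older coordinate `i` leaves.
  · by_cases h' : (a : ℕ) / 2 + 1 < ℓ
    · refine hflip ⟨a / 2 + 1, h'⟩ fun j => ?_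
      have hj := j.2
      simp only [Fin.ext_iff, zigzagVertex, ← decide_not]
      split_ifs <;> rw [decide_eq_decide] <;> omega
    · refine hflip ⟨0, by omega⟩ fun j => ?_
      have hj := j.2
      simp only [Fin.ext_iff, zigzagVertex, ← decide_not]
      split_ifs <;> rw [decide_eq_decide] <;> omega
  · refine hflip ⟨a / 2, by omega⟩ fun j => ?_
    have hj := j.2
    simp only [Fin.ext_iff, zigzagVertex, ← decide_not]
    split_ifs <;> rw [decide_eq_decide] <;> omega

/-- For `ℓ = 2` the pairs `{0, 1}` and `{1, 0}` would coincide, whence `ℓ ≥ 3`. -/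
theorem zigzagVertex_injective (hℓ : 3 ≤ ℓ) : Function.Injective (zigzagVertex ℓ) := by
  intro a b h
  have ha := a.2
  have hb := b.2
  have key (j : ℕ) (hj : j < ℓ) := congrFun h ⟨j, hj⟩
  simp only [zigzagVertex, decide_eq_decide] at key
  have k1 := key (a / 2) (by omega)
  have k2 := key (b / 2) (by omega)
  have k3 := key 0 (by omega)
  have k4 : (a : ℕ) / 2 + 1 < ℓ → _ := key (a / 2 + 1)
  have k5 : (b : ℕ) / 2 + 1 < ℓ → _ := key (b / 2 + 1)
  rw [Fin.ext_iff]
  omega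

/-- The zigzag copy of `C_{2ℓ}` in `Q_ℓ`. -/
def zigzagCopy (hℓ : 3 ≤ ℓ) : Copy (cycleGraph (2 * ℓ)) (hypercube ℓ) where
  toHom :=
    { toFun := zigzagVertex ℓ
      map_rel' := by
        intro a b h
        rcases (cycleGraph_adj_iff_cycleSucc (by omega)).1 h with rfl | rfl
        · exact zigzagVertex_adj hℓ a
        · exact (zigzagVertex_adj hℓ b).symm }
  injective' := zigzagVertex_injective hℓ

theorem zigzagVertex_even {a : Fin (2 * ℓ)} {i : Fin ℓ} (ha : (a : ℕ) = 2 * i) (j : Fin ℓ) :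
    zigzagVertex ℓ a j = true ↔ j = i := by
  simp only [zigzagVertex, decide_eq_true_eq, Fin.ext_iff]
  omega

theorem bitWeight_zigzagVertex_even {a : Fin (2 * ℓ)} (ha : (a : ℕ) % 2 = 0) :
    bitWeight (zigzagVertex ℓ a) = 1 := by
  have := a.2
  rw [bitWeight, Finset.card_eq_one]
  refine ⟨⟨a / 2, by omega⟩, ?_⟩
  ext j
  rw [mem_bitSupport, zigzagVertex_even (i := ⟨a / 2, by omega⟩) (by simp only; omega),
    Finset.mem_singleton]

theorem bitWeight_zigzagVertex_pos (a : Fin (2 * ℓ)) : 1 ≤ bitWeight (zigzagVertex ℓ a) := by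
  have := a.2
  refine Finset.card_pos.2 ⟨⟨a / 2, by omega⟩, ?_⟩
  simp [mem_bitSupport, zigzagVertex]

/-- All edges of the zigzag cycle lie on the same level. -/
theorem min_bitWeight_zigzagVertex (hℓ : 1 ≤ ℓ) {a b : Fin (2 * ℓ)}
    (h : (cycleGraph (2 * ℓ)).Adj a b) :
    min (bitWeight (zigzagVertex ℓ a)) (bitWeight (zigzagVertex ℓ b)) = 1 := by
  rw [cycleGraph_adj_iff_val (by omega)] at h
  have ha := bitWeight_zigzagVertex_pos a
  have hb := bitWeight_zigzagVertex_pos b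
  rcases Nat.mod_two_eq_zero_or_one a with h' | h'
  · rw [bitWeight_zigzagVertex_even h']; omega
  · rw [bitWeight_zigzagVertex_even (a := b) (by omega)]; omega

/-- The frozen coordinates contribute a constant, so levels in a subcube are merely shifted. -/
theorem bitWeight_subcubeCopy {a b : ℕ} (e : Fin a ↪ Fin b) (x : Fin b → Bool) :
    ∃ C, ∀ w, bitWeight (subcubeCopy e x w) = bitWeight w + C := by
  classical
  refine ⟨((bitSupport x).filter fun m => ¬ ∃ i, e i = m).card, fun w => ?_⟩
  have : bitSupport (subcubeCopy e x w) =
      (bitSupport w).map e ∪ (bitSupport x).filter fun m => ¬ ∃ i, e i = m := by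
    ext m
    rw [mem_bitSupport, Finset.mem_union, Finset.mem_map, Finset.mem_filter, mem_bitSupport,
      subcubeCopy_apply]
    by_cases hm : ∃ i, e i = m
    · obtain ⟨i, rfl⟩ := hm
      rw [e.injective.extend_apply]
      simp [mem_bitSupport]
    · rw [Function.extend_apply' _ _ _ hm]
      simp only [hm, not_false_eq_true, and_true]
      refine ⟨.inr, fun h => h.resolve_left ?_⟩
      rintro ⟨i, -, hi⟩
      exact hm ⟨i, hi⟩
  rw [bitWeight, this, Finset.card_union_of_disjoint, Finset.card_map, bitWeight]
  rw [Finset.disjoint_left]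
  intro m hm hm'
  obtain ⟨i, -, hi⟩ := Finset.mem_map.1 hm
  exact (Finset.mem_filter.1 hm').2 ⟨i, hi⟩

/-- The copies of the zigzag cycle in `Q_n`, starting at a lower or at an upper vertex. -/
noncomputable def zigzagFamily (hℓ : 3 ≤ ℓ) (p : (Fin ℓ ↪ Fin n) × (Fin n → Bool) × Bool) :
    Copy (cycleGraph (2 * ℓ)) (hypercube n) :=
  (subcubeCopy p.1 p.2.1).comp
    (bif p.2.2 then (zigzagCopy hℓ).comp (cycleRotation (by omega)) else zigzagCopy hℓ)

theorem zigzagFamily_false (hℓ : 3 ≤ ℓ) (σ : Fin ℓ ↪ Fin n) (x : Fin n → Bool)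
    (a : Fin (2 * ℓ)) :
    zigzagFamily hℓ (σ, x, false) a = Function.extend σ (zigzagVertex ℓ a) x := rfl

theorem zigzagFamily_true (hℓ : 3 ≤ ℓ) (σ : Fin ℓ ↪ Fin n) (x : Fin n → Bool)
    (a : Fin (2 * ℓ)) :
    zigzagFamily hℓ (σ, x, true) a = Function.extend σ (zigzagVertex ℓ (cycleSucc a)) x := rfl

theorem exists_levels_zigzagFamily (hℓ : 3 ≤ ℓ) (k : ℕ)
    (p : (Fin ℓ ↪ Fin n) × (Fin n → Bool) × Bool) :
    ∃ s : Finset ℕ, s.card ≤ 1 ∧ ∀ a b, (cycleGraph (2 * ℓ)).Adj a b →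
      min (bitWeight (zigzagFamily hℓ p a)) (bitWeight (zigzagFamily hℓ p b)) % k ∈ s := by
  obtain ⟨σ, x, b⟩ := p
  obtain ⟨C, hC⟩ := bitWeight_subcubeCopy σ x
  simp only [subcubeCopy_apply] at hC
  refine ⟨{(1 + C) % k}, by simp, fun u v huv => ?_⟩
  rw [Finset.mem_singleton]
  cases b
  · rw [zigzagFamily_false, zigzagFamily_false, hC, hC, min_add_add_right,
      min_bitWeight_zigzagVertex (by omega) huv]
  · have huv' : (cycleGraph (2 * ℓ)).Adj (cycleSucc u) (cycleSucc v) :=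
      (cycleRotation (by omega)).toHom.map_adj huv
    rw [zigzagFamily_true, zigzagFamily_true, hC, hC, min_add_add_right,
      min_bitWeight_zigzagVertex (by omega) huv']

/-- The parameters of a zigzag copy are determined by the copy, up to the base point. -/
theorem extend_zigzagVertex_injective (hℓ : 3 ≤ ℓ) {σ τ : Fin ℓ ↪ Fin n} {x y : Fin n → Bool}
    (h : ∀ a, Function.extend σ (zigzagVertex ℓ a) x = Function.extend τ (zigzagVertex ℓ a) y)
    (hxy : x ∘ σ = y ∘ τ) : σ = τ ∧ x = y := by
  have hστ : σ = τ := by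
    ext j : 1
    -- At position `2 * i` the left side has bit `σ j` set exactly when `j = i`. On the right, this
    -- bit would be constant if `σ j` were outside the range of `τ`.
    have hval (i : Fin ℓ) := congrFun (h ⟨2 * i, by have := i.2; omega⟩) (σ j)
    simp only [σ.injective.extend_apply] at hval
    by_cases hm : ∃ i, τ i = σ j
    · obtain ⟨i, hi⟩ := hm
      have := hval j
      rw [← hi, τ.injective.extend_apply, (zigzagVertex_even rfl j).2 rfl] at this
      rw [← hi, (zigzagVertex_even rfl i).1 this.symm]
    · simp only [Function.extend_apply' _ _ _ hm] at hval
      obtain ⟨i, hi⟩ : ∃ i : Fin ℓ, j ≠ i := by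
        have : Nontrivial (Fin ℓ) := Fin.nontrivial_iff_two_le.2 (by omega)
        exact (exists_ne j).imp fun _ h => h.symm
      have h1 := (hval j).trans (hval i).symm
      rw [(zigzagVertex_even rfl j).2 rfl] at h1
      exact absurd ((zigzagVertex_even rfl j).1 h1.symm) hi
  subst hστ
  refine ⟨rfl, ?_⟩
  ext m
  by_cases hm : ∃ i, σ i = m
  · obtain ⟨i, rfl⟩ := hm
    exact congrFun hxy i
  · have := congrFun (h ⟨0, by omega⟩) m
    rwa [Function.extend_apply' _ _ _ hm, Function.extend_apply' _ _ _ hm] at this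

/-- The copy overwrites the bits of the base point along `σ`; recording them as `x ∘ σ` restores
injectivity. -/
theorem zigzagFamily_injective (hℓ : 3 ≤ ℓ) :
    Function.Injective fun p : (Fin ℓ ↪ Fin n) × (Fin n → Bool) × Bool =>
      (zigzagFamily hℓ p, p.2.1 ∘ p.1) := by
  -- The first step raises the weight in the unrotated cycle and lowers it in the rotated one.
  have hdir (σ τ : Fin ℓ ↪ Fin n) (x y : Fin n → Bool) :
      zigzagFamily hℓ (σ, x, false) ≠ zigzagFamily hℓ (τ, y, true) := by
    intro h
    obtain ⟨C, hC⟩ := bitWeight_subcubeCopy σ x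
    obtain ⟨D, hD⟩ := bitWeight_subcubeCopy τ y
    simp only [subcubeCopy_apply] at hC hD
    let a₀ : Fin (2 * ℓ) := ⟨0, by omega⟩
    let a₁ : Fin (2 * ℓ) := ⟨1, by omega⟩
    let a₂ : Fin (2 * ℓ) := ⟨2, by omega⟩
    have s0 : cycleSucc a₀ = a₁ := by
      have := cycleSucc_val a₀; simp only [a₀] at this; rw [Fin.ext_iff]; simp only [a₀, a₁]; omega
    have s1 : cycleSucc a₁ = a₂ := by
      have := cycleSucc_val a₁; simp only [a₁] at this; rw [Fin.ext_iff]; simp only [a₁, a₂]; omega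
    have e (a) : bitWeight (zigzagFamily hℓ (σ, x, false) a) =
        bitWeight (zigzagFamily hℓ (τ, y, true) a) := by rw [h]
    have e0 := e a₀
    have e1 := e a₁
    rw [zigzagFamily_false, zigzagFamily_true, hC, hD, s0] at e0
    rw [zigzagFamily_false, zigzagFamily_true, hC, hD, s1] at e1
    have w0 : bitWeight (zigzagVertex ℓ a₀) = 1 := bitWeight_zigzagVertex_even rfl
    have w2 : bitWeight (zigzagVertex ℓ a₂) = 1 := bitWeight_zigzagVertex_even (by simp [a₂])
    have w1 := bitWeight_of_adj (s0 ▸ zigzagVertex_adj hℓ a₀)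
    have w1' := bitWeight_zigzagVertex_pos a₁
    omega
  rintro ⟨σ, x, b⟩ ⟨τ, y, c⟩ h
  rw [Prod.mk.injEq] at h
  obtain ⟨h, hxy⟩ := h
  have happ (a) : zigzagFamily hℓ (σ, x, b) a = zigzagFamily hℓ (τ, y, c) a := by rw [h]
  cases b <;> cases c
  · obtain ⟨rfl, rfl⟩ := extend_zigzagVertex_injective hℓ happ hxy
    rfl
  · exact absurd h (hdir _ _ _ _)
  · exact absurd h.symm (hdir _ _ _ _)
  · obtain ⟨rfl, rfl⟩ := extend_zigzagVertex_injective hℓ (fun a => by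
      obtain ⟨b, rfl⟩ := (Finite.injective_iff_surjective.1 cycleSucc_injective) a
      exact happ b) hxy
    rfl

/-- Each copy arises from at most `2 ^ ℓ` parameters, one for each choice of the overwritten bits.
-/
theorem ncard_range_zigzagFamily (hℓ : 3 ≤ ℓ) :
    n.descFactorial ℓ * (2 ^ n * 2) ≤
      (Set.range (zigzagFamily (n := n) hℓ)).ncard * 2 ^ ℓ := by
  have hinj : Function.Injective fun p : (Fin ℓ ↪ Fin n) × (Fin n → Bool) × Bool =>
      ((⟨zigzagFamily hℓ p, Set.mem_range_self p⟩ : Set.range (zigzagFamily (n := n) hℓ)), p.2.1 ∘ p.1) := by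
    intro p q h
    rw [Prod.mk.injEq] at h
    exact zigzagFamily_injective hℓ (Prod.ext (congrArg Subtype.val h.1) h.2)
  have := Nat.card_le_card_of_injective _ hinj
  rw [Nat.card_prod, Nat.card_prod, Nat.card_prod, Nat.card_coe_set_eq] at this
  simpa [Nat.card_eq_fintype_card (α := Fin ℓ ↪ Fin n), Nat.card_fun] using this

end Zigzag

/-! ### Counting all cycles by their directions -/

section Directions

variable {ℓ n : ℕ}

theorem mem_starPositions_toSubgraph {U : Type*} {T : SimpleGraph U}
    (f : Copy T (hypercube n)) (i : Fin n) :
    i ∈ starPositions f.toSubgraph ↔ ∃ a b, T.Adj a b ∧ f a i ≠ f b i := by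
  constructor
  · rintro ⟨x, y, ⟨a, b, hab, rfl, rfl⟩, h⟩
    exact ⟨a, b, hab, h⟩
  · rintro ⟨a, b, hab, h⟩
    exact ⟨f a, f b, ⟨a, b, hab, rfl, rfl⟩, h⟩

theorem exists_direction (hℓ : 1 ≤ ℓ) (f : Copy (cycleGraph (2 * ℓ)) (hypercube n))
    (a : Fin (2 * ℓ)) : ∃ i, f (cycleSucc a) = flipBit (f a) i :=
  hypercube_adj_iff.1 (f.toHom.map_adj (cycleGraph_adj_cycleSucc (by omega) a))

theorem starPositions_eq_range (hℓ : 1 ≤ ℓ) (f : Copy (cycleGraph (2 * ℓ)) (hypercube n))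
    (d : Fin (2 * ℓ) → Fin n) (hd : ∀ a, f (cycleSucc a) = flipBit (f a) (d a)) :
    starPositions f.toSubgraph = Set.range d := by
  have key (a i) : f a i ≠ f (cycleSucc a) i ↔ d a = i := by
    rw [hd, flipBit_apply]
    split_ifs with h <;> simp [h, eq_comm]
  ext i
  rw [mem_starPositions_toSubgraph, Set.mem_range]
  constructor
  · rintro ⟨a, b, hab, h⟩
    rcases (cycleGraph_adj_iff_cycleSucc (by omega)).1 hab with rfl | rfl
    · exact ⟨a, (key _ _).1 h⟩
    · exact ⟨b, (key _ _).1 h.symm⟩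
  · rintro ⟨a, ha⟩
    exact ⟨a, cycleSucc a, cycleGraph_adj_cycleSucc (by omega) a, (key _ _).2 ha⟩

/-- A cycle of length `2 * ℓ` in the hypercube uses at most `ℓ` directions, since each direction
is used at least twice. -/
theorem ncard_starPositions_le (hℓ : 1 ≤ ℓ) (f : Copy (cycleGraph (2 * ℓ)) (hypercube n)) :
    (starPositions f.toSubgraph).ncard ≤ ℓ := by
  classical
  choose d hd using exists_direction hℓ f
  rw [starPositions_eq_range hℓ f d hd]
  have htwo (i) (hi : i ∈ Finset.univ.image d) :
      2 ≤ (Finset.univ.filter fun a => d a = i).card := by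
    by_contra! hlt
    obtain ⟨a, -, rfl⟩ := Finset.mem_image.1 hi
    have huniq (b) (hb : d b = d a) : b = a :=
      Finset.card_le_one.1 (Nat.lt_succ_iff.1 hlt) b (by simpa using hb) a (by simp)
    -- If direction `d a` occurred only at step `a`, its bit would stay constant from `cycleSucc a`
    -- all the way round to `a`.
    have hconst := cycleSucc_induction
      (fun b => f b (d a) = f (cycleSucc a) (d a)) (cycleSucc a) rfl (fun b hb => ?_)
    · have h1 := hconst a
      rw [hd a, flipBit_self] at h1
      revert h1; cases f a (d a) <;> simp
    · by_cases hba : b = a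
      · rw [hba]
      · rw [hd b, flipBit_of_ne _ (fun h => hba (huniq b h.symm)), hb]
  have h1 := Finset.card_eq_sum_card_image d Finset.univ
  have h2 := Finset.card_nsmul_le_sum _ _ _ htwo
  rw [← h1, Finset.card_univ, Fintype.card_fin, smul_eq_mul] at h2
  have h3 : (Set.range d).ncard = (Finset.univ.image d).card := by
    rw [← Set.ncard_coe_finset]; simp
  omega

theorem copy_eq_of_direction (f g : Copy (cycleGraph (2 * ℓ)) (hypercube n))
    (d : Fin (2 * ℓ) → Fin n) (hf : ∀ a, f (cycleSucc a) = flipBit (f a) (d a))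
    (hg : ∀ a, g (cycleSucc a) = flipBit (g a) (d a)) (a₀ : Fin (2 * ℓ)) (h : f a₀ = g a₀) :
    f = g := by
  ext a : 1
  exact cycleSucc_induction (fun a => f a = g a) a₀ h (fun b hb => by rw [hf, hg, hb]) a

/-- There are few cycles of length `2 * ℓ` using fewer than `ℓ` directions. -/
theorem ncard_copies_few_directions_le (hℓ : 2 ≤ ℓ) :
    {f : Copy (cycleGraph (2 * ℓ)) (hypercube n) |
      (starPositions f.toSubgraph).ncard ≤ ℓ - 1}.ncard ≤
      2 ^ n * (n ^ (ℓ - 1) * (ℓ - 1) ^ (2 * ℓ)) := by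
  classical
  let a₀ : Fin (2 * ℓ) := ⟨0, by omega⟩
  -- The direction sequence factors as `u ∘ v` through `ℓ - 1` labels; with the starting vertex, `u`
  -- and `v` determine the cycle.
  have hfac (f : {f : Copy (cycleGraph (2 * ℓ)) (hypercube n) |
      (starPositions f.toSubgraph).ncard ≤ ℓ - 1}) :
      ∃ (u : Fin (ℓ - 1) → Fin n) (v : Fin (2 * ℓ) → Fin (ℓ - 1)),
        ∀ a, f.1 (cycleSucc a) = flipBit (f.1 a) (u (v a)) := by
    obtain ⟨f, hf⟩ := f
    choose d hd using exists_direction (by omega) f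
    rw [Set.mem_ofPred_eq, starPositions_eq_range (by omega) f d hd] at hf
    have hcard : Fintype.card (Set.range d) ≤ Fintype.card (Fin (ℓ - 1)) := by
      rwa [Fintype.card_fin, ← Nat.card_eq_fintype_card, Nat.card_coe_set_eq]
    obtain ⟨e⟩ := Function.Embedding.nonempty_of_card_le hcard
    refine ⟨Function.extend e Subtype.val fun _ => d a₀, fun a => e ⟨d a, a, rfl⟩, fun a => ?_⟩
    rw [e.injective.extend_apply]
    exact hd a
  choose u v huv using hfac
  have hinj : Function.Injective fun f => (f.1 a₀, u f, v f) := by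
    intro f g h
    rw [Prod.mk.injEq, Prod.mk.injEq] at h
    refine Subtype.ext (copy_eq_of_direction f.1 g.1 _ (huv f) (fun a => ?_) a₀ h.1)
    rw [h.2.1, h.2.2]
    exact huv g a
  have := Nat.card_le_card_of_injective _ hinj
  rw [Nat.card_prod, Nat.card_prod, Nat.card_coe_set_eq] at this
  simpa [Nat.card_fun] using this

/-- A cycle of length `2 * ℓ` using exactly `ℓ` directions lies in a subcube of dimension `ℓ`. -/
theorem exists_subcube_of_ncard_starPositions (hℓ : 2 ≤ ℓ)
    (f : Copy (cycleGraph (2 * ℓ)) (hypercube n)) (a₀ : Fin (2 * ℓ))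
    (hf : (starPositions f.toSubgraph).ncard = ℓ) :
    ∃ (D : Finset (Fin n)) (hD : D.card = ℓ) (g : Copy (cycleGraph (2 * ℓ)) (hypercube ℓ)),
      (starPositions g.toSubgraph).ncard = ℓ ∧
      f = (subcubeCopy (D.orderEmbOfFin hD).toEmbedding (f a₀)).comp g := by
  classical
  let D : Finset (Fin n) := (starPositions f.toSubgraph).toFinset
  have hD : D.card = ℓ := by rw [← hf, Set.ncard_eq_toFinset_card']
  let e := D.orderEmbOfFin hD
  have hrange (i) : i ∈ starPositions f.toSubgraph ↔ ∃ j, e j = i := by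
    have : Set.range e = D := D.range_orderEmbOfFin hD
    rw [← Set.mem_range, this]
    simp [D]
  have hconst (a) (i) (hi : i ∉ starPositions f.toSubgraph) : f a i = f a₀ i := by
    refine cycleSucc_induction (fun a => f a i = f a₀ i) a₀ rfl (fun b hb => ?_) a
    rw [mem_starPositions_toSubgraph] at hi
    push Not at hi
    rw [← hb]
    exact (hi b _ (cycleGraph_adj_cycleSucc (by omega) b)).symm
  have hext (a) : f a = Function.extend e (fun j => f a (e j)) (f a₀) := by
    ext i
    by_cases hi : ∃ j, e j = i
    · obtain ⟨j, rfl⟩ := hi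
      rw [e.injective.extend_apply]
    · rw [Function.extend_apply' _ _ _ hi]
      exact hconst a i (mt (hrange i).1 hi)
  let g : Copy (cycleGraph (2 * ℓ)) (hypercube ℓ) :=
    { toHom :=
        { toFun a := fun j => f a (e j)
          map_rel' := by
            intro a b hab
            obtain ⟨i, hi⟩ := hypercube_adj_iff.1 (f.toHom.map_adj hab)
            simp only [Copy.toHom_apply] at hi
            have himem : i ∈ starPositions f.toSubgraph :=
              (mem_starPositions_toSubgraph f i).2 ⟨a, b, hab, by rw [hi, flipBit_self]; simp⟩
            obtain ⟨j, rfl⟩ := (hrange i).1 himem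
            refine hypercube_adj_iff.2 ⟨j, funext fun m => ?_⟩
            rw [hi, flipBit_apply, flipBit_apply]
            simp [e.injective.eq_iff] }
      injective' := by
        intro a b hab
        apply f.injective
        change f a = f b
        rw [hext a, hext b]
        exact congrArg (fun w => Function.extend e w (f a₀)) hab }
  refine ⟨D, hD, g, ?_, Copy.ext hext⟩
  have huniv : starPositions g.toSubgraph = Set.univ := by
    refine Set.eq_univ_of_forall fun j => ?_
    obtain ⟨a, b, hab, h⟩ := (mem_starPositions_toSubgraph f (e j)).1 ((hrange _).2 ⟨j, rfl⟩)
    exact (mem_starPositions_toSubgraph g j).2 ⟨a, b, hab, h⟩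
  rw [huniv, Set.ncard_univ, Nat.card_eq_fintype_card, Fintype.card_fin]

/-- A cycle is determined by its direction set `D`, its pattern in `Q_ℓ` and the frozen bits outside
`D`. The factor `2 ^ ℓ` supplies arbitrary bits on `D`, completing the frozen bits to one of `2 ^ n`
vertices. -/
theorem ncard_copies_all_directions_mul_le (hℓ : 2 ≤ ℓ) :
    {f : Copy (cycleGraph (2 * ℓ)) (hypercube n) |
      (starPositions f.toSubgraph).ncard = ℓ}.ncard * 2 ^ ℓ ≤
      n.choose ℓ * (2 ^ n * {g : Copy (cycleGraph (2 * ℓ)) (hypercube ℓ) |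
        (starPositions g.toSubgraph).ncard = ℓ}.ncard) := by
  classical
  let a₀ : Fin (2 * ℓ) := ⟨0, by omega⟩
  let X := {f : Copy (cycleGraph (2 * ℓ)) (hypercube n) |
      (starPositions f.toSubgraph).ncard = ℓ}
  choose D hD g hg hf using fun f : X => exists_subcube_of_ncard_starPositions hℓ f.1 a₀ f.2
  have hinj : Function.Injective fun p : X × (Fin ℓ → Bool) =>
      ((⟨D p.1, Finset.mem_powersetCard_univ.2 (hD p.1)⟩ :
          Finset.powersetCard ℓ (Finset.univ : Finset (Fin n))),
        Function.extend ((D p.1).orderEmbOfFin (hD p.1)) p.2 (p.1.1 a₀),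
        (⟨g p.1, hg p.1⟩ : {g : Copy (cycleGraph (2 * ℓ)) (hypercube ℓ) |
          (starPositions g.toSubgraph).ncard = ℓ})) := by
    rintro ⟨f, y⟩ ⟨f', y'⟩ h
    rw [Prod.mk.injEq, Prod.mk.injEq] at h
    obtain ⟨h1, h2, h3⟩ := h
    have h1' : D f = D f' := congrArg Subtype.val h1
    have h3' : g f = g f' := congrArg Subtype.val h3
    have he : (D f).orderEmbOfFin (hD f) = (D f').orderEmbOfFin (hD f') := by
      congr!
    simp only at h2
    rw [he] at h2
    set e := (D f').orderEmbOfFin (hD f') with he'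
    have hy : y = y' := by
      ext j
      have := congrFun h2 (e j)
      rwa [e.injective.extend_apply, e.injective.extend_apply] at this
    have hff : f = f' := by
      apply Subtype.ext
      rw [hf f, hf f', h3']
      ext a : 1
      rw [Copy.comp_apply, Copy.comp_apply, subcubeCopy_apply, subcubeCopy_apply, he]
      ext i
      by_cases hi : ∃ j, e j = i
      · obtain ⟨j, rfl⟩ := hi
        exact (e.injective.extend_apply _ _ _).trans (e.injective.extend_apply _ _ _).symm
      · have := congrFun h2 i
        rw [Function.extend_apply' _ _ _ hi, Function.extend_apply' _ _ _ hi] at this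
        exact (Function.extend_apply' _ _ _ hi).trans
          (this.trans (Function.extend_apply' _ _ _ hi).symm)
    rw [hff, hy]
  have := Nat.card_le_card_of_injective _ hinj
  rw [Nat.card_prod, Nat.card_prod, Nat.card_prod, Nat.card_coe_set_eq, Nat.card_coe_set_eq,
    Nat.card_eq_fintype_card (α := Finset.powersetCard ℓ (Finset.univ : Finset (Fin n))),
    Fintype.card_coe, Finset.card_powersetCard, Finset.card_univ, Fintype.card_fin] at this
  simpa [Nat.card_fun] using this

theorem ncard_copies_all_directions (ℓ : ℕ) :
    {g : Copy (cycleGraph (2 * ℓ)) (hypercube ℓ) | (starPositions g.toSubgraph).ncard = ℓ}.ncard =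
      cubeCycleCount ℓ ℓ * Nat.card (cycleGraph (2 * ℓ) ≃g cycleGraph (2 * ℓ)) :=
  ncard_copy_toSubgraph _ _ fun S => (starPositions S).ncard = ℓ

/-- The number of labelled `2 * ℓ`-cycles in the hypercube, up to lower order terms. -/
theorem card_copy_cycleGraph_mul_le (hℓ : 2 ≤ ℓ) :
    Nat.card (Copy (cycleGraph (2 * ℓ)) (hypercube n)) * 2 ^ ℓ ≤
      2 ^ n * (n.choose ℓ * (cubeCycleCount ℓ ℓ * (4 * ℓ)) +
        2 ^ ℓ * (n ^ (ℓ - 1) * (ℓ - 1) ^ (2 * ℓ))) := by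
  have h1 := ncard_copies_few_directions_le (n := n) hℓ
  have h2 := ncard_copies_all_directions_mul_le (n := n) hℓ
  rw [ncard_copies_all_directions] at h2
  have hunion : (Set.univ : Set (Copy (cycleGraph (2 * ℓ)) (hypercube n))) =
      {f | (starPositions f.toSubgraph).ncard = ℓ} ∪
        {f | (starPositions f.toSubgraph).ncard ≤ ℓ - 1} := by
    symm
    refine Set.eq_univ_of_forall fun f => ?_
    have := ncard_starPositions_le (by omega) f
    simp only [Set.mem_union, Set.mem_ofPred_eq]
    omega
  have h3 := Set.ncard_union_le {f : Copy (cycleGraph (2 * ℓ)) (hypercube n) |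
    (starPositions f.toSubgraph).ncard = ℓ} {f | (starPositions f.toSubgraph).ncard ≤ ℓ - 1}
  rw [← hunion, Set.ncard_univ] at h3
  have h4 := card_aut_cycleGraph_le (m := 2 * ℓ) (by omega)
  have h5 : n.choose ℓ * (2 ^ n * (cubeCycleCount ℓ ℓ *
      Nat.card (cycleGraph (2 * ℓ) ≃g cycleGraph (2 * ℓ)))) ≤
      n.choose ℓ * (2 ^ n * (cubeCycleCount ℓ ℓ * (4 * ℓ))) := by
    gcongr
    omega
  calc _ ≤ _ := Nat.mul_le_mul_right _ h3
    _ = _ := add_mul _ _ _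
    _ ≤ _ := add_le_add (h2.trans h5) (Nat.mul_le_mul_right _ h1)
    _ = _ := by ring

end Directions

/-! ### Assembling the bounds -/

section Density

variable {ℓ n k : ℕ}

theorem genTuranDensity_nonneg {V U W : Type*} [Fintype V] (G : SimpleGraph V)
    (T : SimpleGraph U) (H : SimpleGraph W) : 0 ≤ genTuranDensity G T H :=
  div_nonneg (Nat.cast_nonneg _) (Nat.cast_nonneg _)

/-- Every factor of the falling factorial is at least `n / 2`. -/
theorem pow_le_choose_mul (h : 2 * ℓ ≤ n) : n ^ ℓ ≤ n.choose ℓ * (2 ^ ℓ * ℓ.factorial) :=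
  calc n ^ ℓ ≤ (2 * (n + 1 - ℓ)) ^ ℓ := Nat.pow_le_pow_left (by omega) _
    _ = 2 ^ ℓ * (n + 1 - ℓ) ^ ℓ := mul_pow _ _ _
    _ ≤ 2 ^ ℓ * n.descFactorial ℓ := Nat.mul_le_mul_left _ (Nat.pow_sub_le_descFactorial _ _)
    _ = _ := by rw [Nat.descFactorial_eq_factorial_mul_choose]; ring

/-- The zigzag cycles witness the first lower bound on the generalized Turán density. -/
theorem zigzag_le_genTuranDensity (hℓ : 3 ≤ ℓ) (hk : 0 < k) (hn : 2 * ℓ ≤ n) :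
    (1 - 1 / (k : ℝ)) * (((ℓ - 1).factorial : ℝ) / (2 * (cubeCycleCount ℓ ℓ : ℝ))) *
      (1 - ((4 ^ ℓ * ℓ.factorial * (ℓ - 1) ^ (2 * ℓ) : ℕ) : ℝ) / n) ≤
      genTuranDensity (hypercube n) (cycleGraph (2 * ℓ)) (hypercube k) := by
  have hk1 : (1 : ℝ) ≤ k := by exact_mod_cast hk
  have hk0 : 0 ≤ 1 - 1 / (k : ℝ) := sub_nonneg.2 (div_le_one_of_le₀ hk1 (by linarith))
  set ε : ℝ := ((4 ^ ℓ * ℓ.factorial * (ℓ - 1) ^ (2 * ℓ) : ℕ) : ℝ) / n with hε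
  set z := cubeCycleCount ℓ ℓ with hz
  have hdens := genTuranDensity_nonneg (hypercube n) (cycleGraph (2 * ℓ)) (hypercube k)
  -- For small `n` the claimed bound is nonpositive; for `z = 0` it vanishes by the convention for
  -- division by zero.
  rcases lt_or_ge (1 - ε) 0 with hneg | hε1
  · exact (mul_nonpos_of_nonneg_of_nonpos (by positivity) hneg.le).trans hdens
  rcases Nat.eq_zero_or_pos z with hz0 | hz0
  · simpa [hz0] using hdens
  have hzR : (1 : ℝ) ≤ z := by exact_mod_cast hz0
  have hnR : (0 : ℝ) < n := by exact_mod_cast (show 0 < n by omega)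
  set X := Set.range (zigzagFamily (n := n) hℓ)
  obtain ⟨r, hr, hX⟩ := exists_level_copies (cycleGraph (2 * ℓ)) (t := 1) hk X (by
    rintro _ ⟨p, rfl⟩
    exact exists_levels_zigzagFamily hℓ k p)
  have hXcard := ncard_range_zigzagFamily (n := n) hℓ
  have hL := card_copy_cycleGraph_mul_le (n := n) (ℓ := ℓ) (by omega)
  refine le_trans ?_ (le_genTuranDensity _ (exists_cycleGraph_adj (by omega)) _ _
    (levelSubgraph_free hr))
  set S := (copiesIn (levelSubgraph n k r) (cycleGraph (2 * ℓ))).ncard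
  have hXS : (X ∩ copiesIn (levelSubgraph n k r) (cycleGraph (2 * ℓ))).ncard ≤ S :=
    Set.ncard_le_ncard Set.inter_subset_right (Set.toFinite _)
  have hLpos : 0 < Nat.card (Copy (cycleGraph (2 * ℓ)) (hypercube n)) := by
    have hσ : Nonempty (Fin ℓ ↪ Fin n) := ⟨Fin.castLEEmb (by omega)⟩
    exact Nat.card_pos_iff.2
      ⟨⟨zigzagFamily hℓ (hσ.some, fun _ => false, false)⟩, inferInstance⟩
  set L := Nat.card (Copy (cycleGraph (2 * ℓ)) (hypercube n))
  have hLR : (0 : ℝ) < L := by exact_mod_cast hLpos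
  have hkept : (1 - 1 / (k : ℝ)) * X.ncard ≤ S := by
    have h1 : (k : ℝ) * X.ncard ≤ k * S + X.ncard := by
      have : k * X.ncard ≤ k * S + X.ncard := by
        rw [one_mul] at hX
        exact hX.trans (by gcongr)
      exact_mod_cast this
    refine le_of_mul_le_mul_left ?_ (show (0 : ℝ) < k by linarith)
    rw [← mul_assoc, mul_sub, mul_one_div_cancel (by linarith)]
    linarith
  -- Cycles with fewer directions are an `ε` fraction of the main term. The `4 ^ ℓ * ℓ!` in `ε` is
  -- this `2 ^ ℓ` times the `2 ^ ℓ * ℓ!` of `pow_le_choose_mul`.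
  have hsmall : ((2 ^ ℓ * (n ^ (ℓ - 1) * (ℓ - 1) ^ (2 * ℓ)) : ℕ) : ℝ) ≤
      ε * (n.choose ℓ * (z * (4 * ℓ))) := by
    have h1 : ((n ^ ℓ : ℕ) : ℝ) ≤ (n.choose ℓ * (2 ^ ℓ * ℓ.factorial) : ℕ) := by
      exact_mod_cast pow_le_choose_mul hn
    have h2 : n ^ ℓ = n ^ (ℓ - 1) * n := by
      rw [← pow_succ]; congr 1; omega
    rw [h2] at h1
    have h3 : (1 : ℝ) ≤ z * (4 * ℓ) := by
      have : (3 : ℝ) ≤ ℓ := by exact_mod_cast hℓ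
      nlinarith
    have h4 : ε * n.choose ℓ ≤ ε * (n.choose ℓ * (z * (4 * ℓ))) := by
      have hε0 : 0 ≤ ε := by positivity
      gcongr
      exact le_mul_of_one_le_right (by positivity) h3
    refine le_trans ?_ h4
    rw [hε, div_mul_eq_mul_div, le_div_iff₀ hnR]
    have h5 : (4 : ℝ) ^ ℓ = 2 ^ ℓ * 2 ^ ℓ := by rw [← mul_pow]; norm_num
    push_cast at h1 ⊢
    rw [h5]
    calc _ = (2 : ℝ) ^ ℓ * ((ℓ - 1 : ℕ) : ℝ) ^ (2 * ℓ) * ((n : ℝ) ^ (ℓ - 1) * n) := by ring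
      _ ≤ (2 : ℝ) ^ ℓ * ((ℓ - 1 : ℕ) : ℝ) ^ (2 * ℓ) *
          (n.choose ℓ * (2 ^ ℓ * ℓ.factorial)) := by gcongr
      _ = _ := by ring
  -- The count is at most `1 + ε` times the main term, and `(1 - ε) * (1 + ε) ≤ 1`.
  have hLbound : (1 - ε) * (L * 2 ^ ℓ) ≤ 2 ^ n * (n.choose ℓ * (z * (4 * ℓ))) := by
    have h1 : (L : ℝ) * 2 ^ ℓ ≤ 2 ^ n * (n.choose ℓ * (z * (4 * ℓ)) +
        ((2 ^ ℓ * (n ^ (ℓ - 1) * (ℓ - 1) ^ (2 * ℓ)) : ℕ) : ℝ)) := by exact_mod_cast hL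
    set M : ℝ := n.choose ℓ * (z * (4 * ℓ)) with hM
    have hM0 : 0 ≤ M := by positivity
    have h2 : (L : ℝ) * 2 ^ ℓ ≤ 2 ^ n * ((1 + ε) * M) := by
      refine h1.trans ?_
      gcongr
      linarith
    calc (1 - ε) * (L * 2 ^ ℓ) ≤ (1 - ε) * (2 ^ n * ((1 + ε) * M)) := by gcongr
      _ = 2 ^ n * ((1 - ε ^ 2) * M) := by ring
      _ ≤ 2 ^ n * M := by
        gcongr
        exact mul_le_of_le_one_left hM0 (by nlinarith [sq_nonneg ε])
  have hfact : (ℓ.factorial : ℝ) = ℓ * (ℓ - 1).factorial := by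
    exact_mod_cast (Nat.mul_factorial_pred (by omega)).symm
  have hmain : ((ℓ - 1).factorial : ℝ) / (2 * z) * (1 - ε) * L ≤ X.ncard := by
    have h1 : (ℓ.factorial : ℝ) * n.choose ℓ * (2 ^ n * 2) ≤ X.ncard * 2 ^ ℓ := by
      rw [Nat.descFactorial_eq_factorial_mul_choose] at hXcard
      exact_mod_cast hXcard
    have h2 : (0 : ℝ) < 2 ^ ℓ := by positivity
    refine le_of_mul_le_mul_right ?_ h2
    refine le_trans ?_ h1
    calc ((ℓ - 1).factorial : ℝ) / (2 * z) * (1 - ε) * L * 2 ^ ℓ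
        = ((ℓ - 1).factorial : ℝ) / (2 * z) * ((1 - ε) * (L * 2 ^ ℓ)) := by ring
      _ ≤ ((ℓ - 1).factorial : ℝ) / (2 * z) * (2 ^ n * (n.choose ℓ * (z * (4 * ℓ)))) := by
        gcongr
      _ = _ := by
        rw [hfact]
        field_simp
        ring
  rw [le_div_iff₀ hLR]
  calc _ = (1 - 1 / (k : ℝ)) * (((ℓ - 1).factorial : ℝ) / (2 * z) * (1 - ε) * L) := by ring
    _ ≤ (1 - 1 / (k : ℝ)) * X.ncard := by gcongr
    _ ≤ S := hkept

/-- The hypercube contains cycles of every even length from four on. -/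
theorem nonempty_copy_cycleGraph (hℓ : 2 ≤ ℓ) (hn : ℓ ≤ n) :
    Nonempty (Copy (cycleGraph (2 * ℓ)) (hypercube n)) := by
  rcases hℓ.eq_or_lt with rfl | hℓ
  · let v : Fin (2 * 2) → Fin 2 → Bool :=
      ![![false, false], ![true, false], ![true, true], ![false, true]]
    have hadj : ∀ a b : Fin (2 * 2), ((b : ℕ) = a + 1 ∨ (a : ℕ) = b + 1 ∨
        ((a : ℕ) = 0 ∧ (b : ℕ) + 1 = 2 * 2) ∨ ((b : ℕ) = 0 ∧ (a : ℕ) + 1 = 2 * 2)) →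
        hammingDist (v a) (v b) = 1 := by decide
    have hinj : Function.Injective v := by decide
    exact ⟨(subcubeCopy (Fin.castLEEmb hn) fun _ => false).comp
      ⟨⟨v, fun {a b} h => hadj a b ((cycleGraph_adj_iff_val (by norm_num)).1 h)⟩, hinj⟩⟩
  · exact ⟨zigzagFamily hℓ (Fin.castLEEmb hn, fun _ => false, false)⟩

/-- For four-cycles, the first lower bound is dominated by the second one. -/
theorem fourCycle_bound_le (hk : 3 ≤ k) (z : ℕ) {ε : ℝ} (hε : 0 ≤ ε) :
    (1 - 1 / (k : ℝ)) * (((2 - 1).factorial : ℝ) / (2 * (z : ℝ))) * (1 - ε) ≤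
      1 - ((2 : ℕ) : ℝ) / k := by
  have hk3 : (3 : ℝ) ≤ k := by exact_mod_cast hk
  have hk0 : 0 ≤ 1 - 1 / (k : ℝ) := sub_nonneg.2 (div_le_one_of_le₀ (by linarith) (by linarith))
  have hz : ((2 - 1).factorial : ℝ) / (2 * (z : ℝ)) ≤ 1 / 2 := by
    rcases Nat.eq_zero_or_pos z with rfl | h
    · norm_num
    · have : (1 : ℝ) ≤ z := by exact_mod_cast h
      rw [div_le_div_iff₀ (by positivity) (by norm_num)]
      simp only [Nat.add_one_sub_one, Nat.factorial_one, Nat.cast_one]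
      linarith
  calc _ ≤ (1 - 1 / (k : ℝ)) * (((2 - 1).factorial : ℝ) / (2 * (z : ℝ))) :=
        mul_le_of_le_one_right (by positivity) (by linarith)
    _ ≤ (1 - 1 / (k : ℝ)) * (1 / 2) := by gcongr
    -- The difference is `(k - 3) / (2 * k)`, with equality at `k = 3`.
    _ ≤ 1 - ((2 : ℕ) : ℝ) / k := by
        push_cast
        rw [← sub_nonneg]
        have : 1 - 2 / (k : ℝ) - (1 - 1 / (k : ℝ)) * (1 / 2) = (k - 3) / (2 * k) := by
          field_simp; ring
        rw [this]
        exact div_nonneg (by linarith) (by linarith)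

end Density

theorem theorem5 :
    ∃ α : ℝ, 0 < α ∧
      ∀ k ℓ : ℕ, 2 ≤ k → 2 ≤ ℓ → ¬ (k = 2 ∧ ℓ = 2) →
        ∃ ε : ℕ → ℝ, (∀ n, 0 ≤ ε n) ∧ Tendsto ε atTop (𝓝 0) ∧
          ∀ᶠ n : ℕ in atTop,
            max ((1 - 1 / (k : ℝ)) *
                  (((ℓ - 1).factorial : ℝ) / (2 * (cubeCycleCount ℓ ℓ : ℝ))) * (1 - ε n))
                (1 - (ℓ : ℝ) / (k : ℝ))
              ≤ genTuranDensity (hypercube n) (SimpleGraph.cycleGraph (2 * ℓ)) (hypercube k) ∧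
            genTuranDensity (hypercube n) (SimpleGraph.cycleGraph (2 * ℓ)) (hypercube k)
              ≤ 1 - α * (Real.log (k : ℝ) / ((k : ℝ) * 2 ^ k)) := by
  refine ⟨1 / 8, by norm_num, fun k ℓ hk hℓ hkℓ => ?_⟩
  refine ⟨fun n => ((4 ^ ℓ * ℓ.factorial * (ℓ - 1) ^ (2 * ℓ) : ℕ) : ℝ) / n,
    fun n => by positivity, tendsto_const_div_atTop_nhds_zero_nat _, ?_⟩
  filter_upwards [eventually_ge_atTop (2 * ℓ), eventually_ge_atTop (k + 2)] with n hn hnk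
  have hsecond := one_sub_le_genTuranDensity (k := k) hℓ (by omega)
    (nonempty_copy_cycleGraph hℓ (show ℓ ≤ n by omega))
  refine ⟨max_le ?_ hsecond, ?_⟩
  · rcases hℓ.eq_or_lt with rfl | hℓ'
    -- Here the exclusion of `(2, 2)` forces `k ≥ 3`.
    · exact (fourCycle_bound_le (by omega) _ (by positivity)).trans hsecond
    · exact zigzag_le_genTuranDensity hℓ' (by omega) hn
  · have : Nonempty (Fin (2 * ℓ)) := ⟨⟨0, by omega⟩⟩
    exact genTuranDensity_hypercube_le _ (exists_cycleGraph_adj (by omega)) hk hnk
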